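/- Let $k$ be a field of characteristic $0$ and let $\mathcal C$ be a tensor category over $k$: a rigid symmetric monoidal abelian category with $\otimes$ $k$-bilinear and $\mathrm{End}(\mathbf 1)=k$. Assume that the rank $\mathrm{rk}(X)\in\mathrm{End}(\mathbf 1)$ (the trace of $\mathrm{id}_X$) of every object $X$ is a natural number, and let $K$ be an extension field of $k$. Let $T_{\mathcal C}$ be the following many-sorted first-order theory. It has a sort $V_X$ for every object $X$, with $L=V_{\mathbf 1}$; function symbols $+_X:V_X\times V_X\to V_X$ and $\cdot_X:L\times V_X\to V_X$ for every $X$, $v_f:V_X\to V_Y$ for every morphism $f:X\to Y$, and $b_{X,Y}:V_X\times V_Y\to V_{X\otimes Y}$ for all $X,Y$; and a constant of sort $L$ for every element of $K$. The axioms say: 1. $(L,+_{\mathbf 1},\cdot_{\mathbf 1})$ is an algebraically closed field, whose operations on the constants (including zero and one) are those of $K$; 2. $+_X$ and $\cdot_X$ make $V_X$ a vector space over $L$ of dimension $\mathrm{rk}(X)$, and each $v_f$ is $L$-linear; 3. $v_{\mathrm{id}_X}=\mathrm{id}$, $v_{f\circ g}=v_f\circ v_g$, $v_{f+g}=v_f+v_g$,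 $v_{a\cdot\mathrm{id}_X}$ is multiplication by $a\in k\subseteq K$, $v_f=0$ if and only if $f=0$, and $v_f$ is injective (surjective) if and only if $f$ is a monomorphism (an epimorphism); 4. $b_{X,Y}$ is $L$-bilinear, the induced map $V_X\otimes_L V_Y\to V_{X\otimes Y}$ is an isomorphism, and $b$ is compatible with the commutativity and associativity constraints of $\mathcal C$ through the maps $v$. Then: (a) $T_{\mathcal C}$ is stable: for no formula $\varphi(x;y)$ are there a model $M$ of $T_{\mathcal C}$ and tuples $a_i,b_j$ ($i,j\in\mathbb N$) in $M$ such that $M\models\varphi(a_i;b_j)$ if and only if $i<j$. (b) $L$ is stably embedded: for every formula $\varphi(x,y)$ with $y$ a tuple of $n$ variables of sort $L$ (and $x$ a tuple of variables of any sorts) there is a formula $\psi(w,y)$ in the language of rings such that, in each model of $T_{\mathcal C}$ and for each $x$, there is a tuple $w$ in $L$ with $\{y\in L^n:\varphi(x,y)\}=\{y\in L^n:\psi(w,y)\}$. (c) In each model $M$ of $T_{\mathcal C}$, $L$ is a pure algebraically closed field, possibly with additional constants: $L(M)$ is an algebraically closed field (of characteristic $0$), and there is a subset $A\subseteq L(M)$,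 containing the constants from $K$, such that for every $n$ the subsets of $L(M)^n$ that are definable in $M$ without parameters are precisely those that are definable in the field $L(M)$ with constants for the elements of $A$. -/

import Mathlib

open CategoryTheory MonoidalCategory

universe v u r w

noncomputable section

namespace TensorTheory

/-! ## The rank of an object of a rigid symmetric monoidal category -/

section Rank

variable {C : Type u} [Category.{v} C] [MonoidalCategory C] [SymmetricCategory C]
  [RigidCategory C]

/-- The rank of `X`: the trace of the identity of `X`, an element of `End(𝟙)`. -/
def rank (X : C) : 𝟙_ C ⟶ 𝟙_ C :=
  η_ X (Xᘁ) ≫ (β_ X (Xᘁ)).hom ≫ ε_ X (Xᘁ)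

end Rank

section HasRank

variable {C : Type u} [Category.{v} C] [Preadditive C] [MonoidalCategory C]
  [SymmetricCategory C] [RigidCategory C]

/-- The rank of `X` is the natural number `n`. -/
def HasRank (X : C) (n : ℕ) : Prop := rank X = n • 𝟙 (𝟙_ C)

end HasRank

/-! ## The many-sorted language

The sorts are the objects of `C`; the sort of `X` is the sort `V_X`.  The sort `L` is the sort of
the unit object `𝟙_ C`, so that `+_𝟙` and `·_𝟙` are binary operations on `L`. -/

section Language

variable (C : Type u) [Category.{v} C] [MonoidalCategory C] (K : Type r)

/-- Terms, indexed by their sort.  For each sort `X` there are variables `var X 0, var X 1, …` -/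
inductive Term : C → Type (max u v r)
  /-- the `n`-th variable of the sort `V_X` -/
  | var (X : C) (n : ℕ) : Term X
  /-- the constant symbols, of sort `L` -/
  | const (a : K) : Term (𝟙_ C)
  /-- the function symbols `v_f : V_X → V_Y` -/
  | map {X Y : C} (f : X ⟶ Y) (t : Term X) : Term Y
  /-- the function symbols `+_X : V_X × V_X → V_X` -/
  | add {X : C} (s t : Term X) : Term X
  /-- the function symbols `·_X : L × V_X → V_X` -/
  | smul {X : C} (a : Term (𝟙_ C)) (t : Term X) : Term X
  /-- the function symbols `b_{X,Y} : V_X × V_Y → V_{X ⊗ Y}` -/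
  | tensor {X Y : C} (s : Term X) (t : Term Y) : Term (X ⊗ Y)

/-- First-order formulas of the language. -/
inductive Formula : Type (max u v r)
  | falsum : Formula
  | equal {X : C} (s t : Term C K X) : Formula
  | imp (φ ψ : Formula) : Formula
  /-- universal quantification over the `n`-th variable of the sort `V_X` -/
  | all (X : C) (n : ℕ) (φ : Formula) : Formula

/-- Structures for the language.  As usual, all sorts are non-empty. -/
structure Struct where
  /-- the interpretation of the sort `V_X` -/
  carrier : C → Type w
  nonempty : ∀ X, Nonempty (carrier X)
  const : K → carrier (𝟙_ C)
  map : ∀ {X Y : C}, (X ⟶ Y) → carrier X → carrier Y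
  add : ∀ {X : C}, carrier X → carrier X → carrier X
  smul : ∀ {X : C}, carrier (𝟙_ C) → carrier X → carrier X
  tensor : ∀ {X Y : C}, carrier X → carrier Y → carrier (X ⊗ Y)

end Language

section Semantics

variable {C : Type u} [Category.{v} C] [MonoidalCategory C] {K : Type r}

/-- Assignments of elements of `M` to all variables of all sorts. -/
abbrev Struct.Assignment (M : Struct.{v, u, r, w} C K) : Type (max u w) :=
  ∀ X : C, ℕ → M.carrier X

open Classical in
/-- The assignment that gives the value `a` to the `n`-th variable of the sort `V_X`, and agrees
with `v` on all other variables. -/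
def Struct.Assignment.update {M : Struct.{v, u, r, w} C K} (v : M.Assignment) (X : C) (n : ℕ)
    (a : M.carrier X) : M.Assignment :=
  Function.update v X (Function.update (v X) n a)

/-- The value of a term. -/
def Term.value (M : Struct.{v, u, r, w} C K) (v : M.Assignment) :
    ∀ {X : C}, Term C K X → M.carrier X
  | _, .var X n => v X n
  | _, .const a => M.const a
  | _, .map f t => M.map f (t.value M v)
  | _, .add s t => M.add (s.value M v) (t.value M v)
  | _, .smul a t => M.smul (a.value M v) (t.value M v)
  | _, .tensor s t => M.tensor (s.value M v) (t.value M v)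

/-- Satisfaction of a formula in `M` under an assignment. -/
def Formula.Realize (M : Struct.{v, u, r, w} C K) : Formula C K → M.Assignment → Prop
  | .falsum, _ => False
  | .equal s t, v => s.value M v = t.value M v
  | .imp φ ψ, v => φ.Realize M v → ψ.Realize M v
  | .all X n φ, v => ∀ a : M.carrier X, φ.Realize M (v.update X n a)

/-- `M` is a model of the set of axioms `T`.  Free variables of an axiom are understood to be
universally quantified. -/
def Struct.Models (M : Struct.{v, u, r, w} C K) (T : Set (Formula C K)) : Prop :=
  ∀ φ ∈ T, ∀ v : M.Assignment, φ.Realize M v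

end Semantics

/-! ## Abbreviations for terms and formulas -/

section Abbreviations

variable {C : Type u} [Category.{v} C] [MonoidalCategory C] {K : Type r}

notation:65 s:65 " +ᵗ " t:66 => Term.add s t

notation:73 a:74 " •ᵗ " t:73 => Term.smul a t

namespace Formula

/-- negation -/
def neg (φ : Formula C K) : Formula C K := φ.imp falsum

/-- truth -/
def verum : Formula C K := neg falsum

/-- conjunction -/
def and (φ ψ : Formula C K) : Formula C K := neg (φ.imp (neg ψ))

/-- existential quantification -/
def ex (X : C) (n : ℕ) (φ : Formula C K) : Formula C K := neg (all X n (neg φ))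

/-- universal quantification over the variables `N, …, N + n - 1` of the sort `V_X` -/
def allBlock (X : C) (N : ℕ) : ℕ → Formula C K → Formula C K
  | 0, φ => φ
  | n + 1, φ => allBlock X N n (all X (N + n) φ)

/-- existential quantification over the variables `N, …, N + n - 1` of the sort `V_X` -/
def exBlock (X : C) (N : ℕ) : ℕ → Formula C K → Formula C K
  | 0, φ => φ
  | n + 1, φ => exBlock X N n (ex X (N + n) φ)

/-- finite conjunction -/
def conj (l : List (Formula C K)) : Formula C K := l.foldr and verum

end Formula

variable [Field K]

/-- The zero vector of `V_X`, as `0 · x` (in a vector space this is independent of `x`). -/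
def Term.zero (X : C) : Term C K X := Term.const 0 •ᵗ Term.var X 0

/-- The term `a₀ · t₀ + (a₁ · t₁ + (… + 0))`. -/
def Term.lincomb {X : C} {n : ℕ} (a : Fin n → Term C K (𝟙_ C)) (t : Fin n → Term C K X) :
    Term C K X :=
  (List.ofFn fun i => a i •ᵗ t i).foldr Term.add (Term.zero X)

/-- Powers of a term of sort `L`. -/
def Term.pow (t : Term C K (𝟙_ C)) : ℕ → Term C K (𝟙_ C)
  | 0 => Term.const 1
  | n + 1 => t •ᵗ Term.pow t n

open Formula

/-- The formula saying that `t₀, …, tₙ₋₁` is a basis of `V_X` over `L`: the terms span `V_X`, and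
they are linearly independent.  All variables in the terms should have an index below `N`. -/
def basisFormula {X : C} (N : ℕ) {n : ℕ} (t : Fin n → Term C K X) : Formula C K :=
  and
    (all X (N + n) (exBlock (𝟙_ C) N n
      (equal (Term.var X (N + n)) (Term.lincomb (fun i => Term.var (𝟙_ C) (N + i)) t))))
    (allBlock (𝟙_ C) N n
      (imp (equal (Term.lincomb (fun i => Term.var (𝟙_ C) (N + i)) t) (Term.zero X))
        (conj (List.ofFn fun i : Fin n => equal (Term.var (𝟙_ C) (N + i)) (Term.const 0)))))

/-- The sentence saying that `V_X` has dimension `n` over `L`. -/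
def dimFormula (X : C) (n : ℕ) : Formula C K :=
  exBlock X 0 n (basisFormula n fun i : Fin n => Term.var X i)

/-- For `V_X` of dimension `n` and `V_Y` of dimension `m`, and given that `b_{X,Y}` is bilinear,
the sentence saying that the induced linear map from the tensor product of `V_X` and `V_Y` over `L`
to `V_{X ⊗ Y}` is an isomorphism: there are a basis `x₀, …, xₙ₋₁` of `V_X` and a basis
`y₀, …, yₘ₋₁` of `V_Y` such that the `b_{X,Y}(xᵢ, yⱼ)` form a basis of `V_{X ⊗ Y}`. -/
def tensorIsoFormula (X Y : C) (n m : ℕ) : Formula C K :=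
  let x : Fin n → Term C K X := fun i => Term.var X i
  let y : Fin m → Term C K Y := fun j => Term.var Y (n + j)
  exBlock X 0 n (exBlock Y n m
    (and (basisFormula (n + m) x)
      (and (basisFormula (n + m) y)
        (basisFormula (n + m) fun p : Fin (n * m) =>
          Term.tensor (x (finProdFinEquiv.symm p).1) (y (finProdFinEquiv.symm p).2)))))

/-- Every monic polynomial of degree `n` has a root in `L`. -/
def rootFormula (n : ℕ) : Formula C K :=
  let x : Term C K (𝟙_ C) := Term.var (𝟙_ C) n
  ex (𝟙_ C) n (equal
    (x.pow n +ᵗ Term.lincomb (fun i : Fin n => Term.var (𝟙_ C) i) (fun i => x.pow i))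
    (Term.const 0))

end Abbreviations

/-! ## The theory of a tensor category -/

section Theory

variable (k : Type*) [Field k] (C : Type u) [Category.{v} C] [Abelian C] [MonoidalCategory C]
  [SymmetricCategory C] [RigidCategory C] [Linear k C] (K : Type r) [Field K] [Algebra k K]

open Term Formula

/-- The axioms of `T_C`.  Scalar variables are `var (𝟙_ C) n` with `n ≥ 3`, and variables in `V_X`,
`V_Y`, `V_Z` have indices at most `2`, so that distinct letters below are distinct variables also
when `X`, `Y`, `Z`, `𝟙_ C` are not distinct. -/
inductive IsAxiom : Formula C K → Prop
  -- `V_X` is an abelian group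
  | add_assoc (X : C) :
      IsAxiom (equal (var X 0 +ᵗ var X 1 +ᵗ var X 2) (var X 0 +ᵗ (var X 1 +ᵗ var X 2)))
  | add_comm (X : C) : IsAxiom (equal (var X 0 +ᵗ var X 1) (var X 1 +ᵗ var X 0))
  | add_zero (X : C) : IsAxiom (equal (var X 1 +ᵗ zero X) (var X 1))
  | add_neg (X : C) : IsAxiom (ex X 2 (equal (var X 1 +ᵗ var X 2) (zero X)))
  -- scalar multiplication
  | smul_add (X : C) : IsAxiom (equal (var (𝟙_ C) 3 •ᵗ (var X 0 +ᵗ var X 1))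
      (var (𝟙_ C) 3 •ᵗ var X 0 +ᵗ var (𝟙_ C) 3 •ᵗ var X 1))
  | add_smul (X : C) : IsAxiom (equal ((var (𝟙_ C) 3 +ᵗ var (𝟙_ C) 4) •ᵗ var X 0)
      (var (𝟙_ C) 3 •ᵗ var X 0 +ᵗ var (𝟙_ C) 4 •ᵗ var X 0))
  | mul_smul (X : C) : IsAxiom (equal ((var (𝟙_ C) 3 •ᵗ var (𝟙_ C) 4) •ᵗ var X 0)
      (var (𝟙_ C) 3 •ᵗ (var (𝟙_ C) 4 •ᵗ var X 0)))
  | one_smul (X : C) : IsAxiom (equal (const 1 •ᵗ var X 0) (var X 0))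
  -- together with the axioms above for `X = 𝟙_ C`: `L` is a field
  | L_add_zero : IsAxiom (equal (var (𝟙_ C) 3 +ᵗ const 0) (var (𝟙_ C) 3))
  | L_mul_comm : IsAxiom
      (equal (var (𝟙_ C) 3 •ᵗ var (𝟙_ C) 4) (var (𝟙_ C) 4 •ᵗ var (𝟙_ C) 3))
  | L_zero_ne_one : IsAxiom (neg (equal (const 0) (const 1)))
  | L_inv : IsAxiom (imp (neg (equal (var (𝟙_ C) 3) (const 0)))
      (ex (𝟙_ C) 4 (equal (var (𝟙_ C) 3 •ᵗ var (𝟙_ C) 4) (const 1))))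
  -- `L` is algebraically closed
  | L_root (n : ℕ) (hn : 0 < n) : IsAxiom (rootFormula n)
  -- the field operations on the constants are those of `K`
  | const_add (a b : K) : IsAxiom (equal (const a +ᵗ const b) (const (a + b)))
  | const_mul (a b : K) : IsAxiom
      (equal (const a •ᵗ const b) (const (a * b)))
  -- the dimension of `V_X` is the rank of `X`
  | dim (X : C) (n : ℕ) (hn : HasRank X n) : IsAxiom (dimFormula X n)
  -- the maps `v_f` are linear
  | map_add {X Y : C} (f : X ⟶ Y) :
      IsAxiom (equal (map f (var X 0 +ᵗ var X 1)) (map f (var X 0) +ᵗ map f (var X 1)))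
  | map_smul {X Y : C} (f : X ⟶ Y) :
      IsAxiom (equal (map f (var (𝟙_ C) 3 •ᵗ var X 0)) (var (𝟙_ C) 3 •ᵗ map f (var X 0)))
  -- the `k`-linear category structure
  | map_id (X : C) : IsAxiom (equal (map (𝟙 X) (var X 0)) (var X 0))
  | map_comp {X Y Z : C} (f : X ⟶ Y) (g : Y ⟶ Z) :
      IsAxiom (equal (map (f ≫ g) (var X 0)) (map g (map f (var X 0))))
  | map_scalar (X : C) (a : k) : IsAxiom (equal (map (a • 𝟙 X) (var X 0))
      (const (algebraMap k K a) •ᵗ var X 0))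
  | add_map {X Y : C} (f g : X ⟶ Y) :
      IsAxiom (equal (map (f + g) (var X 0)) (map f (var X 0) +ᵗ map g (var X 0)))
  -- `v_f = 0` if and only if `f = 0`
  | map_eq_zero {X Y : C} (f : X ⟶ Y) (hf : f = 0) :
      IsAxiom (equal (map f (var X 0)) (zero Y))
  | map_ne_zero {X Y : C} (f : X ⟶ Y) (hf : f ≠ 0) :
      IsAxiom (ex X 1 (neg (equal (map f (var X 1)) (zero Y))))
  -- `v_f` is injective, or surjective, if and only if `f` is
  | map_inj {X Y : C} (f : X ⟶ Y) (hf : Mono f) :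
      IsAxiom (imp (equal (map f (var X 0)) (map f (var X 1))) (equal (var X 0) (var X 1)))
  | map_not_inj {X Y : C} (f : X ⟶ Y) (hf : ¬ Mono f) :
      IsAxiom (ex X 0 (ex X 1 (and (equal (map f (var X 0)) (map f (var X 1)))
        (neg (equal (var X 0) (var X 1))))))
  | map_surj {X Y : C} (f : X ⟶ Y) (hf : Epi f) :
      IsAxiom (ex X 0 (equal (map f (var X 0)) (var Y 1)))
  | map_not_surj {X Y : C} (f : X ⟶ Y) (hf : ¬ Epi f) :
      IsAxiom (ex Y 1 (all X 0 (neg (equal (map f (var X 0)) (var Y 1)))))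
  -- `b_{X,Y}` is bilinear
  | tensor_add_left (X Y : C) : IsAxiom (equal (tensor (var X 0 +ᵗ var X 1) (var Y 2))
      (tensor (var X 0) (var Y 2) +ᵗ tensor (var X 1) (var Y 2)))
  | tensor_add_right (X Y : C) : IsAxiom (equal (tensor (var X 0) (var Y 1 +ᵗ var Y 2))
      (tensor (var X 0) (var Y 1) +ᵗ tensor (var X 0) (var Y 2)))
  | tensor_smul_left (X Y : C) : IsAxiom (equal (tensor (var (𝟙_ C) 3 •ᵗ var X 0) (var Y 1))
      (var (𝟙_ C) 3 •ᵗ tensor (var X 0) (var Y 1)))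
  | tensor_smul_right (X Y : C) : IsAxiom (equal (tensor (var X 0) (var (𝟙_ C) 3 •ᵗ var Y 1))
      (var (𝟙_ C) 3 •ᵗ tensor (var X 0) (var Y 1)))
  -- the linear map induced by `b_{X,Y}` on the tensor product is an isomorphism
  | tensor_iso (X Y : C) (n m : ℕ) (hn : HasRank X n) (hm : HasRank Y m) :
      IsAxiom (tensorIsoFormula X Y n m)
  -- compatibility with the commutativity and associativity constraints
  | braiding (X Y : C) : IsAxiom (equal (map (β_ X Y).hom (tensor (var X 0) (var Y 1)))
      (tensor (var Y 1) (var X 0)))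
  | associator (X Y Z : C) :
      IsAxiom (equal (map (α_ X Y Z).hom (tensor (tensor (var X 0) (var Y 1)) (var Z 2)))
        (tensor (var X 0) (tensor (var Y 1) (var Z 2))))

/-- The theory `T_C` associated with the tensor category `C` over `k` and the extension `K`. -/
def theory : Set (Formula C K) := {φ | IsAxiom k C K φ}

end Theory

/-! ## Stability -/

section Stability

variable {C : Type u} [Category.{v} C] [MonoidalCategory C] {K : Type r}

open Classical in
/-- The assignment that agrees with `a` on the set `P` of variables, and with `b` outside `P`. -/
def Struct.Assignment.merge {M : Struct.{v, u, r, w} C K} (P : Set (C × ℕ))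
    (a b : M.Assignment) : M.Assignment :=
  fun X n => if (X, n) ∈ P then a X n else b X n

/-- The theory `T` is stable: no formula `φ(x; y)` has the order property, that is, there are no
model `M` of `T` and tuples `aᵢ`, `bⱼ` (`i, j ∈ ℕ`) in `M` such that `φ(aᵢ; bⱼ)` holds if and only
if `i < j`.  The partition of the variables of `φ` into `x` and `y` is given by the set `P` of the
variables in `x`. -/
def Stable (T : Set (Formula C K)) : Prop :=
  ∀ M : Struct.{v, u, r, w} C K, M.Models T →
    ∀ (φ : Formula C K) (P : Set (C × ℕ)) (a b : ℕ → M.Assignment),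
      ¬ ∀ i j : ℕ, φ.Realize M (Struct.Assignment.merge P (a i) (b j)) ↔ i < j

end Stability

/-! ## The field `L` -/

section TheField

variable {C : Type u} [Category.{v} C] [MonoidalCategory C] {K : Type r} [Field K]

/-- The interpretation of the sort `L`. -/
def Struct.L (M : Struct.{v, u, r, w} C K) : Type w := M.carrier (𝟙_ C)

/-- The structure on `L` in the language of rings: addition and multiplication are `+_𝟙` and `·_𝟙`,
zero and one are the constants for `0` and `1`, and the opposite is multiplication by the constant
for `-1`. -/
instance Struct.ringStructure (M : Struct.{v, u, r, w} C K) :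
    FirstOrder.Language.ring.Structure M.L where
  funMap := fun f x => match f, x with
    | .add, x => M.add (x 0) (x 1)
    | .mul, x => M.smul (x 0) (x 1)
    | .neg, x => M.smul (M.const (-1)) (x 0)
    | .zero, _ => M.const 0
    | .one, _ => M.const 1
  RelMap := fun f => nomatch f

open Classical in
/-- The assignment that gives the values `y 0, …, y (n - 1)` to the first `n` variables of the sort
`L`, and agrees with `v` on all other variables. -/
def Struct.Assignment.setL {M : Struct.{v, u, r, w} C K} (v : M.Assignment) {n : ℕ}
    (y : Fin n → M.L) : M.Assignment :=
  Function.update v (𝟙_ C) fun i => if h : i < n then y ⟨i, h⟩ else v (𝟙_ C) i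

/-- The sort `L`, viewed as a structure in the language of rings, is stably embedded in `T`: for
every formula `φ(x, y)`, where `y = (y₀, …, yₙ₋₁)` are variables of the sort `L` and `x` are all the
other variables of `φ` (of any sorts), there is a formula `ψ(w, y)` in the language of rings such
that in each model of `T`, each set of the form `φ(x, L)` is equal to `ψ(w, L)` for some tuple `w`
in `L`. -/
def StablyEmbedded (T : Set (Formula C K)) : Prop :=
  ∀ (φ : Formula C K) (n : ℕ),
    ∃ (m : ℕ) (ψ : FirstOrder.Language.ring.Formula (Fin m ⊕ Fin n)),
      ∀ M : Struct.{v, u, r, w} C K, M.Models T → ∀ x : M.Assignment,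
        ∃ w : Fin m → M.L, ∀ y : Fin n → M.L,
          φ.Realize M (x.setL y) ↔ ψ.Realize (Sum.elim w y)

/-- `S ⊆ Lⁿ` is definable in `M` without parameters: it is defined by a formula that does not
depend on variables other than the first `n` variables of the sort `L`. -/
def Struct.DefinableL (M : Struct.{v, u, r, w} C K) {n : ℕ} (S : Set (Fin n → M.L)) : Prop :=
  ∃ φ : Formula C K, ∀ (v : M.Assignment) (y : Fin n → M.L), y ∈ S ↔ φ.Realize M (v.setL y)

/-- `L` is, in `M`, a pure algebraically closed field of characteristic `0` with additional
constants: it is an algebraically closed field, and there is a set `A ⊆ L`, containing the constants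
from `K`, such that the subsets of the powers of `L` that are definable in `M` without parameters
are precisely those that are definable in the field `L` with constants for the elements of `A`. -/
def Struct.IsPureACF (M : Struct.{v, u, r, w} C K) : Prop :=
  (FirstOrder.Language.Theory.ACF 0).Model M.L ∧
    ∃ A : Set M.L, (∀ a : K, M.const a ∈ A) ∧
      ∀ (n : ℕ) (S : Set (Fin n → M.L)),
        M.DefinableL S ↔ A.Definable FirstOrder.Language.ring S

end TheField

end TensorTheory

end

/-!
Choose bases of all the sorts `V_X` of a model. In coordinates, `+_X`, `·_X`, `v_f` and `b_{X,Y}`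
are polynomial operations over `L`, so every formula of the theory becomes a formula in the language
of rings, evaluated at the coordinates of its variables and at the structure constants of the model.
This gives (b), and reduces (a) and (c) to subsets of the powers of the algebraically closed field
`L` that are definable in the language of rings. By Chevalley's theorem, whether a point belongs to
such a set depends only on which members of a finite set of polynomials vanish at it.

For (a), the value of a polynomial at a point whose coordinates come partly from `a` and partly from
`b` has the form `w(b)(u(a))`, for a vector `u(a)` and a linear form `w(b)` on a finite-dimensional
space. The vectors that are annihilated by `w(b_j)` for almost all `j`, with respect to an
ultrafilter, form a finitely generated subspace, and hence are annihilated simultaneously for almost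
all `j`. So the iterated limits of the truth value of a formula at `a_i`, `b_j` do not depend on the
order of the limits, whereas those of `i < j` do.

For (c), let `A` consist of the elements of `L` that are definable without parameters. The vanishing
ideal of a definable set, truncated to a finite set of monomials, is a definable subspace, and the
members of its reduced echelon basis have coefficients in `A`. So the Zariski closure of a definable
set is defined over `A`, and Noetherian induction on the closure shows that a definable set is a
Boolean combination of closed sets defined over `A`.
-/

noncomputable section

namespace ACFDefinable

open MvPolynomial FirstOrder Topology

section PolynomialMap

variable {F : Type*} [CommRing F] {σ τ : Type*}

/-- The map between affine spaces with the polynomials `f s` as its components. -/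
def polynomialMap (f : σ → MvPolynomial τ F) (y : τ → F) : σ → F := fun s => eval y (f s)

lemma eval_aeval_eq_eval_polynomialMap (f : σ → MvPolynomial τ F) (y : τ → F)
    (p : MvPolynomial σ F) : eval y (aeval f p) = eval (polynomialMap f y) p := by
  simp only [← aeval_eq_eval, ← AlgHom.comp_apply, comp_aeval]
  rfl

lemma polynomialMap_X_comp (i : σ → τ) :
    polynomialMap (fun s => (X (i s) : MvPolynomial τ F)) = fun y => y ∘ i := by
  ext y s
  exact eval_X (i s)

end PolynomialMap

section PointToPoint

variable {F : Type*} [Field F] {σ τ : Type*}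

lemma mem_asIdeal_pointToPoint {x : σ → F} {p : MvPolynomial σ F} :
    p ∈ (pointToPoint x : PrimeSpectrum (MvPolynomial σ F)).asIdeal ↔ eval x p = 0 := by
  simp only [pointToPoint, mem_vanishingIdeal_singleton_iff, aeval_eq_eval]

lemma pointToPoint_mem_zeroLocus {x : σ → F} {s : Set (MvPolynomial σ F)} :
    (pointToPoint x : PrimeSpectrum (MvPolynomial σ F)) ∈ PrimeSpectrum.zeroLocus s ↔
      ∀ p ∈ s, eval x p = 0 :=
  forall₂_congr fun _ _ => mem_asIdeal_pointToPoint

lemma comap_aeval_pointToPoint (f : σ → MvPolynomial τ F) (y : τ → F) :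
    PrimeSpectrum.comap (aeval (R := F) f).toRingHom (pointToPoint y) =
      pointToPoint (polynomialMap f y) := by
  ext p
  simp only [PrimeSpectrum.comap_asIdeal, Ideal.mem_comap, mem_asIdeal_pointToPoint,
    ← eval_aeval_eq_eval_polynomialMap]
  rfl

lemma pointToPoint_injective :
    Function.Injective (pointToPoint : (σ → F) → PrimeSpectrum (MvPolynomial σ F)) := by
  intro x y h
  ext s
  have hmem : X s - C (x s) ∈ (pointToPoint y).asIdeal := by
    simp [← h, mem_asIdeal_pointToPoint]
  simpa [mem_asIdeal_pointToPoint, sub_eq_zero, eq_comm] using hmem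

end PointToPoint

section FinitelyDetermined

variable {F : Type*} [CommRing F] {σ τ : Type*}

/-- A set of points that is a Boolean combination of the zero sets of finitely many polynomials,
phrased as: whether a point belongs to the set depends only on which of the polynomials vanish. -/
def FinitelyDetermined (S : Set (σ → F)) : Prop :=
  ∃ P : Set (MvPolynomial σ F), P.Finite ∧
    ∀ x y : σ → F, (∀ p ∈ P, eval x p = 0 ↔ eval y p = 0) → (x ∈ S ↔ y ∈ S)

lemma FinitelyDetermined.preimage_polynomialMap {S : Set (σ → F)} (hS : FinitelyDetermined S)
    (f : σ → MvPolynomial τ F) : FinitelyDetermined (polynomialMap f ⁻¹' S) := by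
  obtain ⟨P, hP, hdet⟩ := hS
  refine ⟨aeval f '' P, hP.image _, fun x y hxy => hdet _ _ fun p hp => ?_⟩
  simpa only [eval_aeval_eq_eval_polynomialMap] using hxy _ (Set.mem_image_of_mem _ hp)

lemma FinitelyDetermined.preimage_sumElim {S : Set (τ ⊕ σ → F)} (hS : FinitelyDetermined S)
    (x : τ → F) : FinitelyDetermined {y : σ → F | Sum.elim x y ∈ S} := by
  have heval (y : σ → F) : polynomialMap (Sum.elim (fun i => C (x i)) X) y = Sum.elim x y := by
    ext (i | i) <;> simp [polynomialMap]
  simpa only [Set.preimage, heval] using hS.preimage_polynomialMap (Sum.elim (fun i => C (x i)) X)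

end FinitelyDetermined

section Constructible

variable {F : Type*} [Field F] {σ τ : Type*}

/-- A subset of affine space is constructible if it consists of the rational points in a
constructible subset of the prime spectrum of the polynomial ring. -/
def IsConstructibleSet (S : Set (σ → F)) : Prop :=
  ∃ Z : Set (PrimeSpectrum (MvPolynomial σ F)), IsConstructible Z ∧ pointToPoint ⁻¹' Z = S

namespace IsConstructibleSet

lemma empty : IsConstructibleSet (∅ : Set (σ → F)) :=
  ⟨∅, .empty, rfl⟩

lemma compl {S : Set (σ → F)} (hS : IsConstructibleSet S) : IsConstructibleSet Sᶜ := by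
  obtain ⟨Z, hZ, rfl⟩ := hS
  exact ⟨Zᶜ, hZ.compl, rfl⟩

lemma union {S T : Set (σ → F)} (hS : IsConstructibleSet S) (hT : IsConstructibleSet T) :
    IsConstructibleSet (S ∪ T) := by
  obtain ⟨Z, hZ, rfl⟩ := hS
  obtain ⟨W, hW, rfl⟩ := hT
  exact ⟨Z ∪ W, hZ.union hW, rfl⟩

lemma eval_eq_zero (p : MvPolynomial σ F) : IsConstructibleSet {x : σ → F | eval x p = 0} := by
  refine ⟨PrimeSpectrum.zeroLocus {p}, ?_, ?_⟩
  · rw [← isConstructible_compl, ← PrimeSpectrum.basicOpen_eq_zeroLocus_compl]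
    exact PrimeSpectrum.isConstructible_basicOpen
  · ext x
    exact pointToPoint_mem_zeroLocus.trans (by simp)

end IsConstructibleSet

lemma IsConstructibleSet.finitelyDetermined {S : Set (σ → F)} (hS : IsConstructibleSet S) :
    FinitelyDetermined S := by
  obtain ⟨Z, hZ, rfl⟩ := hS
  obtain ⟨D, rfl⟩ := PrimeSpectrum.exists_constructibleSetData_iff.mpr hZ
  refine ⟨⋃ C ∈ D, insert C.f (Set.range C.g),
    D.finite_toSet.biUnion fun C _ => (Set.finite_range _).insert _, fun x y hxy => ?_⟩
  simp only [PrimeSpectrum.ConstructibleSetData.toSet, Set.mem_preimage,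
    PrimeSpectrum.BasicConstructibleSetData.toSet, Set.mem_iUnion, Set.mem_sdiff,
    pointToPoint_mem_zeroLocus]
  refine exists_congr fun C => exists_congr fun hC => and_congr
    (forall₂_congr fun p hp => hxy p ?_) (not_congr (forall₂_congr fun p hp => hxy p ?_))
  · exact Set.mem_biUnion hC (Set.mem_insert_of_mem _ hp)
  · exact Set.mem_biUnion hC (Set.mem_singleton_iff.mp hp ▸ Set.mem_insert _ _)

variable [IsAlgClosed F] [Finite τ]

lemma exists_pointToPoint_mem {Z : Set (PrimeSpectrum (MvPolynomial τ F))}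
    (hZ : IsConstructible Z) (hne : Z.Nonempty) : ∃ y : τ → F, pointToPoint y ∈ Z := by
  obtain ⟨D, rfl⟩ := PrimeSpectrum.exists_constructibleSetData_iff.mpr hZ
  obtain ⟨q, hq⟩ := hne
  obtain ⟨E, hE, hqE⟩ : ∃ E ∈ D, q ∈ E.toSet := by
    simpa only [PrimeSpectrum.ConstructibleSetData.toSet, Set.mem_iUnion, exists_prop] using hq
  have hlocallyClosed : IsLocallyClosed E.toSet :=
    (PrimeSpectrum.isClosed_zeroLocus _).isLocallyClosed.inter
      (PrimeSpectrum.isClosed_zeroLocus _).isOpen_compl.isLocallyClosed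
  obtain ⟨m, hmE, hm⟩ := nonempty_inter_closedPoints ⟨q, hqE⟩ hlocallyClosed
  rw [mem_closedPoints_iff, PrimeSpectrum.isClosed_singleton_iff_isMaximal,
    isMaximal_iff_eq_vanishingIdeal_singleton] at hm
  obtain ⟨y, hy⟩ := hm
  obtain rfl : m = pointToPoint y := PrimeSpectrum.ext hy
  exact ⟨y, Set.mem_biUnion hE hmE⟩

lemma isConstructible_comap_preimage_pointToPoint [Finite σ]
    (f : MvPolynomial σ F →+* MvPolynomial τ F) (x : σ → F) :
    IsConstructible (PrimeSpectrum.comap f ⁻¹' {pointToPoint x}) := by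
  have hclosed : IsClosed (PrimeSpectrum.comap f ⁻¹' {pointToPoint x}) := by
    refine IsClosed.preimage (PrimeSpectrum.continuous_comap f) ?_
    rw [PrimeSpectrum.isClosed_singleton_iff_isMaximal]
    exact isMaximal_iff_eq_vanishingIdeal_singleton.mpr ⟨x, rfl⟩
  exact isConstructible_compl.mp
    ((TopologicalSpace.NoetherianSpace.isCompact _).isConstructible hclosed.isOpen_compl)

lemma finitePresentation_toRingHom_mvPolynomial [Finite σ]
    (f : MvPolynomial σ F →ₐ[F] MvPolynomial τ F) : f.toRingHom.FinitePresentation := by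
  refine RingHom.FinitePresentation.of_comp_finiteType (C : F →+* MvPolynomial σ F) ?_
    (RingHom.finiteType_algebraMap.mpr inferInstance)
  rw [show f.toRingHom.comp C = algebraMap F _ from f.comp_algebraMap]
  exact RingHom.finitePresentation_algebraMap.mpr inferInstance

/-- Chevalley's theorem, on rational points: by the Nullstellensatz, the non-empty fibres of the
map of spectra over rational points contain rational points. -/
lemma IsConstructibleSet.image_polynomialMap [Finite σ] {S : Set (τ → F)}
    (hS : IsConstructibleSet S) (f : σ → MvPolynomial τ F) :
    IsConstructibleSet (polynomialMap f '' S) := by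
  obtain ⟨Z, hZ, rfl⟩ := hS
  refine ⟨PrimeSpectrum.comap (aeval f).toRingHom '' Z,
    PrimeSpectrum.isConstructible_comap_image (finitePresentation_toRingHom_mvPolynomial _) hZ,
    Set.ext fun x => ⟨?_, ?_⟩⟩
  · rintro ⟨q, hq, hqx⟩
    obtain ⟨y, hy, hyx⟩ := exists_pointToPoint_mem
      (hZ.inter (isConstructible_comap_preimage_pointToPoint (aeval f).toRingHom x)) ⟨q, hq, hqx⟩
    refine ⟨y, hy, pointToPoint_injective ?_⟩
    rwa [← comap_aeval_pointToPoint]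
  · rintro ⟨y, hy, rfl⟩
    exact ⟨pointToPoint y, hy, comap_aeval_pointToPoint f y⟩

lemma IsConstructibleSet.image_comp [Finite σ] {S : Set (τ → F)} (hS : IsConstructibleSet S)
    (i : σ → τ) : IsConstructibleSet ((fun y => y ∘ i) '' S) := by
  simpa only [polynomialMap_X_comp] using hS.image_polynomialMap fun s => X (i s)

end Constructible

section Formulas

lemma exists_restrict_realize {L : Language} {I β : Type*} (χ : L.Formula (I ⊕ β)) :
    ∃ (m : ℕ) (ι : Fin m → I) (ψ : L.Formula (Fin m ⊕ β)),
      ∀ (F : Type w) [L.Structure F] (x : I → F) (y : β → F),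
        χ.Realize (Sum.elim x y) ↔ ψ.Realize (Sum.elim (x ∘ ι) y) := by
  classical
  let s := χ.freeVarFinset.toLeft
  refine ⟨s.card, fun j => (s.equivFin.symm j).1,
    χ.restrictFreeVar fun a => match a with
      | ⟨.inl i, h⟩ => .inl (s.equivFin ⟨i, Finset.mem_toLeft.mpr h⟩)
      | ⟨.inr b, _⟩ => .inr b, fun F _ x y => ?_⟩
  refine (Language.BoundedFormula.realize_restrictFreeVar _ ?_).symm
  rintro ⟨i | b, h⟩ <;> simp

lemma exists_eval_eq_realize {F α : Type*} [CommRing F] [Ring.CompatibleRing F]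
    (t : Language.ring.Term α) :
    ∃ p : MvPolynomial α F, ∀ x : α → F, eval x p = t.realize x := by
  induction t with
  | var a => exact ⟨X a, fun x => by simp⟩
  | func f ts ih =>
    choose p hp using ih
    cases f with
    | add =>
      exact ⟨p 0 + p 1, fun x => by
        rw [map_add, hp, hp]
        exact (Ring.CompatibleRing.funMap_add fun i => (ts i).realize x).symm⟩
    | mul =>
      exact ⟨p 0 * p 1, fun x => by
        rw [map_mul, hp, hp]
        exact (Ring.CompatibleRing.funMap_mul fun i => (ts i).realize x).symm⟩
    | neg =>
      exact ⟨-p 0, fun x => by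
        rw [map_neg, hp]
        exact (Ring.CompatibleRing.funMap_neg fun i => (ts i).realize x).symm⟩
    | zero =>
      exact ⟨0, fun x => by
        rw [map_zero]
        exact (Ring.CompatibleRing.funMap_zero (R := F) _).symm⟩
    | one =>
      exact ⟨1, fun x => by
        rw [map_one]
        exact (Ring.CompatibleRing.funMap_one (R := F) _).symm⟩

variable {F : Type*} [Field F] [IsAlgClosed F] [Ring.CompatibleRing F] {α : Type*}

lemma isConstructibleSet_realize [Finite α] {n : ℕ} (φ : Language.ring.BoundedFormula α n) :
    IsConstructibleSet {x : α ⊕ Fin n → F | φ.Realize (x ∘ Sum.inl) (x ∘ Sum.inr)} := by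
  induction φ with
  | falsum => exact .empty
  | equal s t =>
    obtain ⟨p, hp⟩ := exists_eval_eq_realize (F := F) s
    obtain ⟨q, hq⟩ := exists_eval_eq_realize (F := F) t
    convert IsConstructibleSet.eval_eq_zero (p - q) using 3 with x
    simp [hp, hq, sub_eq_zero, Language.BoundedFormula.Realize]
  | rel R => nomatch R
  | imp φ ψ hφ hψ =>
    convert hφ.compl.union hψ using 1
    ext x
    simp [Language.BoundedFormula.realize_imp, imp_iff_not_or]
  | @all n φ hφ =>
    convert (hφ.compl.image_comp (Sum.map id Fin.castSucc : α ⊕ Fin n → α ⊕ Fin (n + 1))).compl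
      using 1
    ext x
    constructor
    · rintro h ⟨y, hy, rfl⟩
      refine hy ?_
      rw [Set.mem_ofPred_eq, ← Fin.snoc_init_self (y ∘ Sum.inr)]
      exact h (y (Sum.inr (Fin.last n)))
    · refine fun h a => by_contra fun hφa => h ⟨Sum.elim (x ∘ Sum.inl) (Fin.snoc (x ∘ Sum.inr) a),
        hφa, ?_⟩
      ext (s | s) <;> simp

lemma finitelyDetermined_realize (φ : Language.ring.Formula α) :
    FinitelyDetermined {x : α → F | φ.Realize x} := by
  classical
  let ψ : Language.ring.Formula φ.freeVarFinset := φ.restrictFreeVar id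
  have hψ (x : α → F) : ψ.Realize (x ∘ Subtype.val) ↔ φ.Realize x :=
    Language.BoundedFormula.realize_restrictFreeVar x fun _ => rfl
  let f : φ.freeVarFinset ⊕ Fin 0 → MvPolynomial α F := Sum.elim (fun a => X a.1) finZeroElim
  have hf (x : α → F) : polynomialMap f x ∘ Sum.inl = x ∘ Subtype.val :=
    funext fun a => eval_X a.1
  have hpre := (isConstructibleSet_realize (F := F) ψ).finitelyDetermined.preimage_polynomialMap f
  convert hpre using 1
  ext x
  rw [Set.mem_ofPred_eq, ← hψ, Set.mem_preimage, Set.mem_ofPred_eq, hf, Language.Formula.Realize,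
    Subsingleton.elim (polynomialMap f x ∘ Sum.inr) default]

end Formulas

open Filter

section IteratedLimits

variable {ι κ : Type*}

/-- The vectors annihilated by `g j` for almost all `j` form a submodule, which is finitely
generated. -/
lemma eventually_apply_eq_zero_swap {R V W : Type*} [Semiring R] [AddCommMonoid V] [Module R V]
    [IsNoetherian R V] [AddCommMonoid W] [Module R W] {l : Filter ι} {l' : Filter κ}
    {f : ι → V} {g : κ → V →ₗ[R] W} (h : ∀ᶠ i in l, ∀ᶠ j in l', g j (f i) = 0) :
    ∀ᶠ j in l', ∀ᶠ i in l, g j (f i) = 0 := by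
  let N : Submodule R V :=
    { carrier := {x | ∀ᶠ j in l', g j x = 0}
      add_mem' := fun hx hy => by
        filter_upwards [hx, hy] with j hx hy
        rw [map_add, hx, hy, add_zero]
      zero_mem' := Eventually.of_forall fun j => map_zero (g j)
      smul_mem' := fun c x hx => by
        filter_upwards [hx] with j hx
        rw [map_smul, hx, smul_zero] }
  obtain ⟨s, hs⟩ := IsNoetherian.noetherian N
  have hker : ∀ᶠ j in l', ∀ x ∈ s, g j x = 0 :=
    (eventually_all_finset s).mpr fun x hx => hs.le (Submodule.subset_span hx)
  filter_upwards [hker] with j hj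
  filter_upwards [h] with i hi
  exact (Submodule.span_le (p := LinearMap.ker (g j))).mpr hj (hs.ge hi)

variable {F σ : Type*} [CommRing F] (Q : Set σ) [∀ s, Decidable (s ∈ Q)]

lemma eval_piecewise (x y : σ → F) (p : MvPolynomial σ F) :
    eval (Q.piecewise x y) p = ∑ m ∈ p.support,
      (∏ s ∈ m.support with s ∉ Q, y s ^ m s) *
        (p.coeff m * ∏ s ∈ m.support with s ∈ Q, x s ^ m s) := by
  rw [eval_eq]
  refine Finset.sum_congr rfl fun m _ => ?_
  rw [mul_left_comm, mul_comm (∏ s ∈ m.support with s ∉ Q, _),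
    ← Finset.prod_filter_mul_prod_filter_not m.support (· ∈ Q)]
  congr 2
  · exact Finset.prod_congr rfl fun s hs => by
      rw [Q.piecewise_eq_of_mem _ _ (Finset.mem_filter.mp hs).2]
  · exact Finset.prod_congr rfl fun s hs => by
      rw [Q.piecewise_eq_of_notMem _ _ (Finset.mem_filter.mp hs).2]

variable [IsNoetherianRing F]

lemma eventually_eval_piecewise_eq_zero_swap {l : Filter ι} {l' : Filter κ} {x : ι → σ → F}
    {y : κ → σ → F} {p : MvPolynomial σ F}
    (h : ∀ᶠ i in l, ∀ᶠ j in l', eval (Q.piecewise (x i) (y j)) p = 0) :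
    ∀ᶠ j in l', ∀ᶠ i in l, eval (Q.piecewise (x i) (y j)) p = 0 := by
  let f (i : ι) (m : p.support) : F := p.coeff m.1 * ∏ s ∈ m.1.support with s ∈ Q, x i s ^ m.1 s
  let g (j : κ) : (p.support → F) →ₗ[F] F :=
    ∑ m : p.support, (∏ s ∈ m.1.support with s ∉ Q, y j s ^ m.1 s) • LinearMap.proj m
  have hfg (i : ι) (j : κ) : eval (Q.piecewise (x i) (y j)) p = g j (f i) := by
    rw [eval_piecewise, ← Finset.sum_coe_sort]
    simp only [g, f, LinearMap.sum_apply, LinearMap.smul_apply, LinearMap.proj_apply, smul_eq_mul]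
  simp only [hfg] at h ⊢
  exact eventually_apply_eq_zero_swap h

lemma eventually_eval_piecewise_eq_zero_swap_iff {l : Filter ι} {l' : Filter κ} {x : ι → σ → F}
    {y : κ → σ → F} {p : MvPolynomial σ F} :
    (∀ᶠ i in l, ∀ᶠ j in l', eval (Q.piecewise (x i) (y j)) p = 0) ↔
      ∀ᶠ j in l', ∀ᶠ i in l, eval (Q.piecewise (x i) (y j)) p = 0 := by
  classical
  refine ⟨eventually_eval_piecewise_eq_zero_swap Q, fun h => ?_⟩
  have hcompl (i : ι) (j : κ) : Q.piecewise (x i) (y j) = Qᶜ.piecewise (y j) (x i) :=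
    (Set.piecewise_compl Q (y j) (x i)).symm
  simp only [hcompl] at h ⊢
  exact eventually_eval_piecewise_eq_zero_swap Qᶜ h

lemma eventually_eventually_iff (U : Ultrafilter ι) (U' : Ultrafilter κ) (A : ι → κ → Prop) :
    ∀ᶠ i in U, ∀ᶠ j in U', (A i j ↔ ∀ᶠ i in U, ∀ᶠ j in U', A i j) := by
  by_cases hA : ∀ᶠ i in U, ∀ᶠ j in U', A i j
  · simp only [hA, iff_true]
  · simp only [hA, iff_false, Ultrafilter.eventually_not, not_false_eq_true]

variable {S : Set (σ → F)}

lemma FinitelyDetermined.eventually_piecewise_mem_swap_iff (hS : FinitelyDetermined S)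
    (U : Ultrafilter ι) (U' : Ultrafilter κ) (x : ι → σ → F) (y : κ → σ → F) :
    (∀ᶠ i in U, ∀ᶠ j in U', Q.piecewise (x i) (y j) ∈ S) ↔
      ∀ᶠ j in U', ∀ᶠ i in U, Q.piecewise (x i) (y j) ∈ S := by
  obtain ⟨P, hP, hdet⟩ := hS
  let limit (p : MvPolynomial σ F) : Prop :=
    ∀ᶠ i in U, ∀ᶠ j in U', eval (Q.piecewise (x i) (y j)) p = 0
  have hlimit : ∀ᶠ i in U, ∀ᶠ j in U', ∀ p ∈ P,
      (eval (Q.piecewise (x i) (y j)) p = 0 ↔ limit p) := by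
    simp only [eventually_all_finite hP]
    exact fun p _ => eventually_eventually_iff U U' _
  have hlimit' : ∀ᶠ j in U', ∀ᶠ i in U, ∀ p ∈ P,
      (eval (Q.piecewise (x i) (y j)) p = 0 ↔ limit p) := by
    simp only [eventually_all_finite hP, limit, eventually_eval_piecewise_eq_zero_swap_iff]
    exact fun p _ => eventually_eventually_iff U' U _
  obtain ⟨i₀, hi₀⟩ := hlimit.exists
  obtain ⟨j₀, h₀⟩ := hi₀.exists
  have hmem {i : ι} {j : κ}
      (hij : ∀ p ∈ P, (eval (Q.piecewise (x i) (y j)) p = 0 ↔ limit p)) :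
      Q.piecewise (x i) (y j) ∈ S ↔ Q.piecewise (x i₀) (y j₀) ∈ S :=
    hdet _ _ fun p hp => (hij p hp).trans (h₀ p hp).symm
  have hS₀ := eventually_congr <|
    hlimit.mono fun i hi => eventually_congr <| hi.mono fun j => hmem
  have hS₀' := eventually_congr <|
    hlimit'.mono fun j hj => eventually_congr <| hj.mono fun i => hmem
  simp only [eventually_const] at hS₀ hS₀'
  rw [hS₀, hS₀']

lemma FinitelyDetermined.not_piecewise_mem_iff_lt (hS : FinitelyDetermined S)
    (x y : ℕ → σ → F) : ¬ ∀ i j, Q.piecewise (x i) (y j) ∈ S ↔ i < j := by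
  intro h
  have hgt (n : ℕ) : ∀ᶠ m in hyperfilter ℕ, n < m :=
    Nat.hyperfilter_le_atTop (eventually_gt_atTop n)
  have hswap := hS.eventually_piecewise_mem_swap_iff Q (hyperfilter ℕ) (hyperfilter ℕ) x y
  simp only [h] at hswap
  obtain ⟨j, hj⟩ := (hswap.mp (Eventually.of_forall hgt)).exists
  obtain ⟨i, hij, hji⟩ := (hj.and (hgt j)).exists
  exact hij.asymm hji

end IteratedLimits

section DefinableElements

variable (L : Language) (F : Type*) [L.Structure F]

/-- The definable closure of the empty set: the elements whose singletons are definable without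
parameters. -/
def definableElements : Set F :=
  {c | (∅ : Set F).Definable₁ L {c}}

variable {L F} {ι : Type*}

lemma definable_empty_of_definable_definableElements {S : Set (ι → F)}
    (hS : (definableElements L F).Definable L S) : (∅ : Set F).Definable L S := by
  obtain ⟨A, hA, hS⟩ := Set.definable_iff_finitely_definable.mp hS
  obtain ⟨χ, rfl⟩ := Set.definable_iff_exists_formula_sum.mp hS
  have hχ : (∅ : Set F).Definable L {z : ι ⊕ A → F | χ.Realize (z ∘ Sum.swap)} :=
    (Set.empty_definable_iff.mpr ⟨χ, rfl⟩).preimage_comp Sum.swap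
  have hparam (a : A) : (∅ : Set F).Definable L {z : ι ⊕ A → F | z (Sum.inr a) = a} :=
    (hA a.2 : (∅ : Set F).Definable₁ L {a.1}).preimage_comp fun _ => Sum.inr a
  convert (hχ.inter (Set.definable_iInter_of_finite hparam)).exists_of_finite using 1
  ext v
  have hswap (u : A → F) : Sum.elim v u ∘ Sum.swap = Sum.elim u v := by
    ext (a | i) <;> rfl
  simp only [Set.mem_ofPred_eq, Set.mem_inter_iff, Set.mem_iInter, Sum.elim_inr, hswap,
    ← funext_iff (g := fun a : A => a.1), exists_eq_right]
  rfl

lemma apply_mem_definableElements [Finite ι] {b : ι → F}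
    (hb : (∅ : Set F).Definable L {b}) (i : ι) : b i ∈ definableElements L F := by
  have himage := hb.image_comp fun _ : Fin 1 => i
  rw [Set.image_singleton] at himage
  change (∅ : Set F).Definable L {x : Fin 1 → F | x 0 ∈ ({b i} : Set F)}
  convert himage using 1
  ext x
  simp [funext_iff]

end DefinableElements

section Descent

lemma exists_echelon_basis {F ι : Type*} [Field F] [Finite ι] [DecidableEq ι]
    (W : Submodule F (ι → F)) :
    ∃ (J : Finset ι) (b : J → ι → F),
      (∀ j, (W : Set (ι → F)) ∩ {x | ∀ i : J, x i = if i = j then 1 else 0} = {b j}) ∧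
      Submodule.span F (Set.range b) = W := by
  have := Fintype.ofFinite ι
  obtain ⟨J, hJ, hJmin⟩ := exists_minimal_of_wellFoundedLT
    (fun J : Finset ι => ∀ x ∈ W, (∀ i : J, x i = 0) → x = 0)
    ⟨Finset.univ, fun x _ hx => funext fun j => hx ⟨j, Finset.mem_univ j⟩⟩
  have hexists (j : J) : ∃ b ∈ W, ∀ i : J, b i = if i = j then 1 else 0 := by
    obtain ⟨x, hxW, hx, hx0⟩ : ∃ x ∈ W, (∀ i : J.erase j, x i = 0) ∧ x ≠ 0 := by
      by_contra! h
      exact Finset.notMem_erase j.1 J (hJmin h (Finset.erase_subset _ _) j.2)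
    have hx' (i : J) (hij : i ≠ j) : x i = 0 :=
      hx ⟨i, Finset.mem_erase.mpr ⟨Subtype.coe_ne_coe.mpr hij, i.2⟩⟩
    have hxj : x j ≠ 0 := fun hxj => hx0 <| hJ x hxW fun i => by
      by_cases hij : i = j
      · rw [hij, hxj]
      · exact hx' i hij
    refine ⟨(x j)⁻¹ • x, W.smul_mem _ hxW, fun i => ?_⟩
    split_ifs with hij
    · simp [hij, hxj]
    · simp [hx' i hij]
  choose b hbW hb using hexists
  have heq_of_eq_on {x y : ι → F} (hx : x ∈ W) (hy : y ∈ W) (h : ∀ i : J, x i = y i) : x = y :=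
    sub_eq_zero.mp <| hJ _ (W.sub_mem hx hy) fun i => sub_eq_zero.mpr (h i)
  refine ⟨J, b, fun j => ?_, le_antisymm ?_ fun x hx => ?_⟩
  · refine Set.eq_singleton_iff_unique_mem.mpr ⟨⟨hbW j, hb j⟩, fun x hx => ?_⟩
    exact heq_of_eq_on hx.1 (hbW j) fun i => (hx.2 i).trans (hb j i).symm
  · exact Submodule.span_le.mpr (Set.range_subset_iff.mpr hbW)
  · rw [heq_of_eq_on hx (y := ∑ j : J, x j • b j)
      (W.sum_mem fun j _ => W.smul_mem _ (hbW j)) (fun i => by simp [hb])]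
    exact Submodule.sum_mem _ fun j _ =>
      Submodule.smul_mem _ _ (Submodule.subset_span (Set.mem_range_self j))

section Coefficients

variable {F : Type*} [CommRing F] {ι σ : Type*}

variable (F) in
/-- The polynomial with prescribed coefficients at the monomials in `Mon`. -/
def polynomialOfCoeffs (Mon : Finset (σ →₀ ℕ)) : (Mon → F) →ₗ[F] MvPolynomial σ F :=
  Fintype.linearCombination F fun m => monomial m.1 1

lemma polynomialOfCoeffs_apply {Mon : Finset (σ →₀ ℕ)} (x : Mon → F) :
    polynomialOfCoeffs F Mon x = ∑ m, monomial m.1 (x m) := by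
  simp [polynomialOfCoeffs, Fintype.linearCombination_apply, smul_monomial]

lemma polynomialOfCoeffs_coeff {Mon : Finset (σ →₀ ℕ)} {p : MvPolynomial σ F}
    (hp : p.support ⊆ Mon) : polynomialOfCoeffs F Mon (fun m => p.coeff m) = p := by
  rw [polynomialOfCoeffs_apply, Finset.sum_coe_sort Mon fun m => monomial m (p.coeff m),
    ← Finset.sum_subset hp]
  · exact p.as_sum.symm
  · exact fun m _ hm => by rw [notMem_support_iff.mp hm, monomial_zero]

lemma exists_coeff_polynomialOfCoeffs_eq {Mon : Finset (σ →₀ ℕ)} {x : Mon → F} {d : σ →₀ ℕ}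
    (hd : d ∈ (polynomialOfCoeffs F Mon x).support) :
    ∃ m, (polynomialOfCoeffs F Mon x).coeff d = x m := by
  classical
  have hcoeff : (polynomialOfCoeffs F Mon x).coeff d = ∑ m, if m.1 = d then x m else 0 := by
    simp only [polynomialOfCoeffs_apply, coeff_sum, coeff_monomial]
  by_cases hdMon : d ∈ Mon
  · refine ⟨⟨d, hdMon⟩, hcoeff.trans ?_⟩
    rw [Finset.sum_eq_single ⟨d, hdMon⟩ (fun m _ hm => if_neg (Subtype.coe_ne_coe.mpr hm))
      (by simp), if_pos rfl]
  · refine absurd (hcoeff.trans ?_) (mem_support_iff.mp hd)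
    exact Finset.sum_eq_zero fun m _ => if_neg fun (hm : m.1 = d) => hdMon (hm ▸ m.2)

variable [Ring.CompatibleRing F]

lemma definable_freeCommRing_lift_eq_zero (p : FreeCommRing ι) :
    (∅ : Set F).Definable Language.ring {x : ι → F | FreeCommRing.lift x p = 0} :=
  Set.empty_definable_iff.mpr ⟨(Ring.termOfFreeCommRing p).equal (Ring.termOfFreeCommRing 0), by
    ext x
    simp [Language.Formula.realize_equal]⟩

lemma definable_eval_polynomialOfCoeffs_eq_zero (Mon : Finset (σ →₀ ℕ)) :
    (∅ : Set F).Definable Language.ring {z : Mon ⊕ σ → F |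
      eval (z ∘ Sum.inr) (polynomialOfCoeffs F Mon (z ∘ Sum.inl)) = 0} := by
  convert definable_freeCommRing_lift_eq_zero (F := F)
    (∑ m : Mon, .of (Sum.inl m) * m.1.prod fun i n => .of (Sum.inr i) ^ n) using 3 with z
  simp [polynomialOfCoeffs_apply, eval_monomial, Finsupp.prod]

end Coefficients

variable {F : Type*} [Field F] [Ring.CompatibleRing F] {ι σ : Type*} {L : Language}
  [L.Structure F]

/-- The vectors of the reduced echelon basis are singled out by some of their coordinates. -/
lemma exists_finite_span_eq_of_definable [Finite ι] (e : Language.ring →ᴸ L) [e.IsExpansionOn F]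
    {W : Submodule F (ι → F)} (hW : (∅ : Set F).Definable L (W : Set (ι → F))) :
    ∃ s : Set (ι → F), s.Finite ∧ Submodule.span F s = W ∧
      ∀ x ∈ s, ∀ i, x i ∈ definableElements L F := by
  classical
  obtain ⟨J, b, hb, hspan⟩ := exists_echelon_basis W
  refine ⟨Set.range b, Set.finite_range b, hspan, Set.forall_mem_range.mpr fun j => ?_⟩
  refine apply_mem_definableElements ?_
  rw [← hb j, Set.ofPred_forall]
  refine hW.inter (Set.definable_iInter_of_finite fun i => ?_)
  convert (definable_freeCommRing_lift_eq_zero (F := F)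
    (.of i.1 - if i = j then 1 else 0)).map_expansion e using 3
  split_ifs <;> simp [sub_eq_zero]

lemma definable_polynomialOfCoeffs_mem_vanishingIdeal [Finite σ] (e : Language.ring →ᴸ L)
    [e.IsExpansionOn F] {T : Set (σ → F)} (hT : (∅ : Set F).Definable L T)
    (Mon : Finset (σ →₀ ℕ)) :
    (∅ : Set F).Definable L {x | polynomialOfCoeffs F Mon x ∈ vanishingIdeal F T} := by
  convert ((hT.preimage_comp Sum.inr).compl.union
    ((definable_eval_polynomialOfCoeffs_eq_zero Mon).map_expansion e)).forall_of_finite using 1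
  ext x
  simp [mem_vanishingIdeal_iff, aeval_eq_eval, imp_iff_not_or]

lemma exists_span_eq_vanishingIdeal [Finite σ] (e : Language.ring →ᴸ L) [e.IsExpansionOn F]
    {T : Set (σ → F)} (hT : (∅ : Set F).Definable L T) :
    ∃ P : Finset (MvPolynomial σ F), Ideal.span P = vanishingIdeal F T ∧
      ∀ p ∈ P, ∀ d ∈ p.support, p.coeff d ∈ definableElements L F := by
  classical
  obtain ⟨G, hG⟩ := IsNoetherian.noetherian (vanishingIdeal F T)
  let W := ((vanishingIdeal F T).restrictScalars F).comap
    (polynomialOfCoeffs F (G.biUnion support))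
  obtain ⟨s, hs, hspan, hcoeff⟩ := exists_finite_span_eq_of_definable e (W := W)
    (definable_polynomialOfCoeffs_mem_vanishingIdeal e hT _)
  refine ⟨hs.toFinset.image (polynomialOfCoeffs F _), le_antisymm ?_ ?_, ?_⟩
  · rw [Ideal.span_le, Finset.coe_image, hs.coe_toFinset, Set.image_subset_iff]
    exact Submodule.span_le.mp hspan.le
  · rw [← hG, Submodule.span_le]
    intro p hp
    have hpMon : p.support ⊆ G.biUnion support := Finset.subset_biUnion_of_mem support hp
    have hpW : (fun m => p.coeff m.1) ∈ W := by
      change polynomialOfCoeffs F _ _ ∈ vanishingIdeal F T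
      rw [polynomialOfCoeffs_coeff hpMon, ← hG]
      exact Submodule.subset_span hp
    rw [← polynomialOfCoeffs_coeff hpMon]
    refine Submodule.span_le_restrictScalars F _ _ ?_
    rw [Finset.coe_image, hs.coe_toFinset, ← Submodule.map_span, hspan]
    exact Submodule.mem_map_of_mem hpW
  · simp only [Finset.forall_mem_image, hs.mem_toFinset]
    intro x hx d hd
    obtain ⟨m, hm⟩ := exists_coeff_polynomialOfCoeffs_eq hd
    exact hm ▸ hcoeff x hx m

lemma definable_zeroLocus_vanishingIdeal [Finite σ] (e : Language.ring →ᴸ L) [e.IsExpansionOn F]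
    {T : Set (σ → F)} (hT : (∅ : Set F).Definable L T) :
    (definableElements L F).Definable Language.ring (zeroLocus F (vanishingIdeal F T)) := by
  obtain ⟨P, hP, hcoeff⟩ := exists_span_eq_vanishingIdeal e hT
  rw [← hP]
  refine (Ring.mvPolynomial_zeroLocus_definable P).mono (Set.iUnion₂_subset fun p hp => ?_)
  rintro _ ⟨d, hd, rfl⟩
  exact hcoeff p hp d hd

end Descent

section NoetherianInduction

variable {F : Type*} [Field F] {σ : Type*}

/-- A finitely determined set and its complement are not both Zariski dense in a nonempty set
`T`: at the points of `T` where as few of the determining polynomials vanish as possible, the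
same polynomials vanish on a Zariski open part of `T`. -/
lemma FinitelyDetermined.vanishingIdeal_lt {S T : Set (σ → F)} (hS : FinitelyDetermined S)
    (hT : T.Nonempty) :
    vanishingIdeal F T < vanishingIdeal F (T ∩ S) ∨
      vanishingIdeal F T < vanishingIdeal F (T \ S) := by
  classical
  obtain ⟨P, hP, hS⟩ := hS
  obtain ⟨x, hx, hmin⟩ := exists_minimalFor_of_wellFoundedLT (· ∈ T)
    (fun x => hP.toFinset.filter fun p => eval x p = 0) hT
  let q := ∏ p ∈ hP.toFinset with eval x p ≠ 0, p
  have hqx : eval x q ≠ 0 := by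
    simp [q, map_prod, Finset.prod_ne_zero_iff]
  have hqy {y : σ → F} (hy : y ∈ T) (hq : eval y q ≠ 0) : x ∈ S ↔ y ∈ S := by
    have hyx : ∀ p ∈ P, eval y p = 0 → eval x p = 0 := fun p hp hyp => by
      by_contra hxp
      refine hq ?_
      rw [map_prod]
      exact Finset.prod_eq_zero (by simp [hp, hxp]) hyp
    refine hS x y fun p hp => ⟨fun hxp => ?_, hyx p hp⟩
    have hsub := hmin hy fun p hp => by
      simp only [Finset.mem_filter, hP.mem_toFinset] at hp ⊢
      exact ⟨hp.1, hyx p hp.1 hp.2⟩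
    exact (Finset.mem_filter.mp (hsub (by simp [hp, hxp]))).2
  have hlt {T' : Set (σ → F)} (hT' : T' ⊆ T) (hq : ∀ y ∈ T', eval y q = 0) :
      vanishingIdeal F T < vanishingIdeal F T' :=
    lt_of_le_not_ge (vanishingIdeal_anti_mono hT') fun hle =>
      hqx (aeval_eq_eval x ▸ hle (fun y hy => (aeval_eq_eval y ▸ hq y hy)) x hx)
  by_cases hxS : x ∈ S
  · exact .inr (hlt Set.sdiff_subset fun y hy => by_contra fun hq => hy.2 ((hqy hy.1 hq).mp hxS))
  · exact .inl (hlt Set.inter_subset_left fun y hy =>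
      by_contra fun hq => hxS ((hqy hy.1 hq).mpr hy.2))

lemma subset_zeroLocus_vanishingIdeal (T : Set (σ → F)) : T ⊆ zeroLocus F (vanishingIdeal F T) :=
  (zeroLocus_vanishingIdeal_galoisConnection (k := F) (K := F)).l_u_le T

variable [Ring.CompatibleRing F] {L : Language} [L.Structure F]

/-- Noetherian induction on the Zariski closure `Z` of `T`: by `vanishingIdeal_lt`, the set `S` is
already known on a closed set that contains `Z ∩ S` or `Z \ S`. -/
lemma FinitelyDetermined.definable_inter_zeroLocus [Finite σ] (e : Language.ring →ᴸ L)
    [e.IsExpansionOn F] {S T : Set (σ → F)} (hS : FinitelyDetermined S)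
    (hSdef : (∅ : Set F).Definable L S) (hT : (∅ : Set F).Definable L T) :
    (definableElements L F).Definable Language.ring (S ∩ zeroLocus F (vanishingIdeal F T)) := by
  induction h : vanishingIdeal F T using WellFoundedGT.induction generalizing T with
  | ind I ih =>
    subst h
    let Z := zeroLocus F (vanishingIdeal F T)
    have hZ : (definableElements L F).Definable Language.ring Z :=
      definable_zeroLocus_vanishingIdeal e hT
    have hZ' : (∅ : Set F).Definable L Z :=
      definable_empty_of_definable_definableElements (hZ.map_expansion e)
    rcases Z.eq_empty_or_nonempty with hempty | hne
    · rw [show zeroLocus F (vanishingIdeal F T) = ∅ from hempty, Set.inter_empty]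
      exact Set.definable_empty
    have hclosure : vanishingIdeal F Z = vanishingIdeal F T :=
      (zeroLocus_vanishingIdeal_galoisConnection (k := F) (K := F)).u_l_u_eq_u T
    have hsubset {T' : Set (σ → F)} (hT' : T' ⊆ Z) : zeroLocus F (vanishingIdeal F T') ⊆ Z :=
      zeroLocus_anti_mono (hclosure ▸ vanishingIdeal_anti_mono hT')
    rcases hS.vanishingIdeal_lt hne with hlt | hlt
    · convert ih _ (hclosure ▸ hlt) (hZ'.inter hSdef) rfl using 1
      refine subset_antisymm (fun x hx => ⟨hx.1, ?_⟩)
        (Set.inter_subset_inter_right _ (hsubset Set.inter_subset_left))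
      exact subset_zeroLocus_vanishingIdeal _ hx.symm
    · have hdiff := hZ'.sdiff hSdef
      convert hZ.sdiff ((definable_zeroLocus_vanishingIdeal e hdiff).sdiff
        (ih _ (hclosure ▸ hlt) hdiff rfl)) using 1
      ext x
      have hx : x ∈ Z \ S → x ∈ zeroLocus F (vanishingIdeal F (Z \ S)) :=
        fun hx => subset_zeroLocus_vanishingIdeal _ hx
      simp only [Set.mem_inter_iff, Set.mem_sdiff] at hx ⊢
      tauto

theorem definable_empty_iff_of_finitelyDetermined [Finite σ] (e : Language.ring →ᴸ L)
    [e.IsExpansionOn F] {S : Set (σ → F)}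
    (hS : (∅ : Set F).Definable L S → FinitelyDetermined S) :
    (∅ : Set F).Definable L S ↔ (definableElements L F).Definable Language.ring S := by
  refine ⟨fun hSdef => ?_, fun hSdef =>
    definable_empty_of_definable_definableElements (hSdef.map_expansion e)⟩
  convert (hS hSdef).definable_inter_zeroLocus e hSdef Set.definable_univ using 1
  exact (Set.inter_eq_left.mpr
    ((Set.subset_univ S).trans (subset_zeroLocus_vanishingIdeal _))).symm

end NoetherianInduction

end ACFDefinable

namespace TensorTheory

section Assignments

variable {C : Type u} [Category.{v} C] [MonoidalCategory C] {K : Type r}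

instance Struct.instNonemptyCarrier (M : Struct.{v, u, r, w} C K) (X : C) :
    Nonempty (M.carrier X) :=
  M.nonempty X

variable {M : Struct.{v, u, r, w} C K}

namespace Struct.Assignment

@[simp]
lemma update_same (a : M.Assignment) (X : C) (n : ℕ) (x : M.carrier X) :
    a.update X n x X n = x := by
  simp [update]

@[simp]
lemma update_of_ne (a : M.Assignment) (X Y : C) {m n : ℕ} (x : M.carrier X) (h : m ≠ n) :
    a.update X n x Y m = a Y m := by
  by_cases hXY : Y = X
  · subst hXY; simp [update, h]
  · simp [update, hXY]

lemma update_of_ne_sort (a : M.Assignment) {X Y : C} (m n : ℕ) (x : M.carrier X) (h : Y ≠ X) :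
    a.update X n x Y m = a Y m := by
  simp [update, h]

open Classical in
/-- The assignment that gives the values `x 0, …, x (n - 1)` to the variables `N, …, N + n - 1` of
the sort `V_X`, and agrees with `a` on all other variables. -/
def updateBlock (a : M.Assignment) (X : C) (N : ℕ) {n : ℕ} (x : Fin n → M.carrier X) :
    M.Assignment :=
  Function.update a X (Function.extend (fun i : Fin n => N + i) x (a X))

@[simp]
lemma updateBlock_add (a : M.Assignment) (X : C) (N : ℕ) {n : ℕ} (x : Fin n → M.carrier X)
    (i : Fin n) : a.updateBlock X N x X (N + i) = x i := by
  have hinj : Function.Injective fun i : Fin n => N + (i : ℕ) :=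
    fun _ _ h => Fin.ext (Nat.add_left_cancel h)
  simpa only [updateBlock, Function.update_self] using hinj.extend_apply x (a X) i

@[simp]
lemma updateBlock_zero_apply (a : M.Assignment) (X : C) {n : ℕ} (x : Fin n → M.carrier X)
    (i : Fin n) : a.updateBlock X 0 x X i = x i := by
  simpa only [zero_add] using a.updateBlock_add X 0 x i

lemma updateBlock_of_forall_ne (a : M.Assignment) (X Y : C) {m N n : ℕ}
    (x : Fin n → M.carrier X) (h : ∀ i : Fin n, N + i ≠ m) :
    a.updateBlock X N x Y m = a Y m := by
  by_cases hXY : Y = X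
  · subst hXY
    simpa only [updateBlock, Function.update_self] using
      Function.extend_apply' x (a Y) m fun ⟨i, hi⟩ => h i hi
  · simp [updateBlock, hXY]

@[simp]
lemma updateBlock_of_lt (a : M.Assignment) (X Y : C) {m N n : ℕ} (x : Fin n → M.carrier X)
    (h : m < N) : a.updateBlock X N x Y m = a Y m :=
  a.updateBlock_of_forall_ne X Y x fun _ => by omega

@[simp]
lemma updateBlock_of_le (a : M.Assignment) (X Y : C) {m N n : ℕ} (x : Fin n → M.carrier X)
    (h : N + n ≤ m) : a.updateBlock X N x Y m = a Y m :=
  a.updateBlock_of_forall_ne X Y x fun _ => by omega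

lemma updateBlock_of_ne_sort (a : M.Assignment) {X Y : C} (m N : ℕ) {n : ℕ}
    (x : Fin n → M.carrier X) (h : Y ≠ X) : a.updateBlock X N x Y m = a Y m := by
  simp [updateBlock, h]

@[simp]
lemma updateBlock_elim0 (a : M.Assignment) (X : C) (N : ℕ) (x : Fin 0 → M.carrier X) :
    a.updateBlock X N x = a := by
  ext Y m
  exact a.updateBlock_of_forall_ne X Y x nofun

lemma update_updateBlock (a : M.Assignment) (X : C) (N : ℕ) {n : ℕ} (x : Fin n → M.carrier X)
    (y : M.carrier X) :
    (a.updateBlock X N x).update X (N + n) y =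
      a.updateBlock X N (Fin.snoc (α := fun _ => M.carrier X) x y) := by
  ext Y m
  by_cases hXY : Y = X
  · subst hXY
    by_cases h : ∃ i : Fin (n + 1), N + (i : ℕ) = m
    · obtain ⟨i, rfl⟩ := h
      rw [updateBlock_add]
      induction i using Fin.lastCases with
      | last => simp only [Fin.val_last, update_same, Fin.snoc_last]
      | cast i =>
        rw [update_of_ne _ _ _ _ (by have := i.2; simp; omega), Fin.val_castSucc,
          updateBlock_add, Fin.snoc_castSucc]
    · push Not at h
      have hlast : m ≠ N + n := by simpa using (h (Fin.last n)).symm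
      rw [update_of_ne _ _ _ _ hlast, updateBlock_of_forall_ne _ _ _ _ h,
        updateBlock_of_forall_ne _ _ _ _ fun i => h i.castSucc]
  · rw [update_of_ne_sort _ _ _ _ hXY, updateBlock_of_ne_sort _ _ _ _ hXY,
      updateBlock_of_ne_sort _ _ _ _ hXY]

lemma setL_eq_updateBlock (a : M.Assignment) {n : ℕ} (y : Fin n → M.L) :
    a.setL y = a.updateBlock (𝟙_ C) 0 (n := n) y := by
  ext X m
  by_cases hX : X = 𝟙_ C
  · subst hX
    by_cases h : m < n
    · simpa [setL, h] using (a.updateBlock_zero_apply (𝟙_ C) (n := n) y ⟨m, h⟩).symm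
    · rw [updateBlock_of_le (N := 0) (n := n) a _ _ y (by omega)]
      simp [setL, h]
  · simp [setL, updateBlock, hX]

end Struct.Assignment

namespace Formula

variable {v : M.Assignment}

@[simp]
lemma realize_neg (φ : Formula C K) : (neg φ).Realize M v ↔ ¬ φ.Realize M v := Iff.rfl

@[simp]
lemma realize_verum : (verum : Formula C K).Realize M v := id

@[simp]
lemma realize_and (φ ψ : Formula C K) :
    (φ.and ψ).Realize M v ↔ φ.Realize M v ∧ ψ.Realize M v := by
  simp [Formula.and, neg, Realize]

@[simp]
lemma realize_ex (X : C) (n : ℕ) (φ : Formula C K) :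
    (ex X n φ).Realize M v ↔ ∃ x : M.carrier X, φ.Realize M (v.update X n x) := by
  simp [ex, neg, Realize]

open Struct.Assignment in
@[simp]
lemma realize_exBlock (X : C) (N n : ℕ) (φ : Formula C K) :
    (exBlock X N n φ).Realize M v ↔
      ∃ x : Fin n → M.carrier X, φ.Realize M (v.updateBlock X N x) := by
  induction n generalizing φ with
  | zero => simp [exBlock]
  | succ n ih =>
    simp only [exBlock, ih, realize_ex, update_updateBlock]
    exact ⟨fun ⟨x, y, h⟩ => ⟨Fin.snoc x y, h⟩,
      fun ⟨x, h⟩ => ⟨Fin.init x, x (Fin.last n), by rwa [Fin.snoc_init_self]⟩⟩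

open Struct.Assignment in
@[simp]
lemma realize_allBlock (X : C) (N n : ℕ) (φ : Formula C K) :
    (allBlock X N n φ).Realize M v ↔
      ∀ x : Fin n → M.carrier X, φ.Realize M (v.updateBlock X N x) := by
  induction n generalizing φ with
  | zero => simp [allBlock]
  | succ n ih =>
    simp only [allBlock, ih, Realize, update_updateBlock]
    exact ⟨fun h x => by simpa only [Fin.snoc_init_self] using h (Fin.init x) (x (Fin.last n)),
      fun h x y => h (Fin.snoc x y)⟩

lemma realize_conj (l : List (Formula C K)) :
    (conj l).Realize M v ↔ ∀ φ ∈ l, φ.Realize M v := by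
  induction l with
  | nil => simp [conj]
  | cons φ l ih => rw [List.forall_mem_cons, ← ih]; exact realize_and φ (conj l)

end Formula

end Assignments

section LinearStructure

variable {C : Type u} [Category.{v} C] [MonoidalCategory C] {K : Type r} [Field K]

/-- The part of the axioms of `T_C` saying that `L` is a field containing the constants and the
sorts `V_X` are vector spaces over `L`. Dimensions are not prescribed. -/
class Struct.HasVectorSpaces (M : Struct.{v, u, r, w} C K) : Prop where
  add_assoc : ∀ {X : C} (x y z : M.carrier X), M.add (M.add x y) z = M.add x (M.add y z)
  add_comm : ∀ {X : C} (x y : M.carrier X), M.add x y = M.add y x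
  add_zero : ∀ {X : C} (x y : M.carrier X), M.add x (M.smul (M.const 0) y) = x
  smul_add : ∀ {X : C} (a : M.carrier (𝟙_ C)) (x y : M.carrier X),
    M.smul a (M.add x y) = M.add (M.smul a x) (M.smul a y)
  add_smul : ∀ {X : C} (a b : M.carrier (𝟙_ C)) (x : M.carrier X),
    M.smul (M.add a b) x = M.add (M.smul a x) (M.smul b x)
  mul_smul : ∀ {X : C} (a b : M.carrier (𝟙_ C)) (x : M.carrier X),
    M.smul (M.smul a b) x = M.smul a (M.smul b x)
  one_smul : ∀ {X : C} (x : M.carrier X), M.smul (M.const 1) x = x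
  L_add_zero : ∀ a : M.carrier (𝟙_ C), M.add a (M.const 0) = a
  L_mul_comm : ∀ a b : M.carrier (𝟙_ C), M.smul a b = M.smul b a
  L_zero_ne_one : M.const 0 ≠ M.const 1
  L_inv : ∀ a : M.carrier (𝟙_ C), a ≠ M.const 0 → ∃ b, M.smul a b = M.const 1
  const_add : ∀ a b : K, M.add (M.const a) (M.const b) = M.const (a + b)
  const_mul : ∀ a b : K, M.smul (M.const a) (M.const b) = M.const (a * b)

/-- The part of the axioms of `T_C` that is linear algebra: on top of the vector spaces `V_X`, the
maps `v_f` are linear and the maps `b_{X,Y}` are bilinear. -/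
class Struct.IsLinear (M : Struct.{v, u, r, w} C K) : Prop extends M.HasVectorSpaces where
  map_add : ∀ {X Y : C} (f : X ⟶ Y) (x y : M.carrier X),
    M.map f (M.add x y) = M.add (M.map f x) (M.map f y)
  map_smul : ∀ {X Y : C} (f : X ⟶ Y) (a : M.carrier (𝟙_ C)) (x : M.carrier X),
    M.map f (M.smul a x) = M.smul a (M.map f x)
  tensor_add_left : ∀ {X Y : C} (x x' : M.carrier X) (y : M.carrier Y),
    M.tensor (M.add x x') y = M.add (M.tensor x y) (M.tensor x' y)
  tensor_add_right : ∀ {X Y : C} (x : M.carrier X) (y y' : M.carrier Y),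
    M.tensor x (M.add y y') = M.add (M.tensor x y) (M.tensor x y')
  tensor_smul_left : ∀ {X Y : C} (a : M.carrier (𝟙_ C)) (x : M.carrier X) (y : M.carrier Y),
    M.tensor (M.smul a x) y = M.smul a (M.tensor x y)
  tensor_smul_right : ∀ {X Y : C} (a : M.carrier (𝟙_ C)) (x : M.carrier X) (y : M.carrier Y),
    M.tensor x (M.smul a y) = M.smul a (M.tensor x y)

namespace Struct

section VectorSpaces

variable (M : Struct.{v, u, r, w} C K) [hM : M.HasVectorSpaces]

lemma L_zero_add (a : M.carrier (𝟙_ C)) : M.add (M.const 0) a = a :=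
  (hM.add_comm _ _).trans (hM.L_add_zero a)

lemma smul_const_zero_eq {X : C} (x y : M.carrier X) :
    M.smul (M.const 0) x = M.smul (M.const 0) y := by
  rw [← hM.add_zero (M.smul (M.const 0) x) y, hM.add_comm, hM.add_zero]

lemma const_zero_smul (a : M.carrier (𝟙_ C)) : M.smul (M.const 0) a = M.const 0 := by
  rw [← M.L_zero_add (M.smul _ _), hM.add_zero]

lemma neg_add {X : C} (x : M.carrier X) :
    M.add (M.smul (M.const (-1)) x) x = M.smul (M.const 0) x := by
  nth_rewrite 2 [← hM.one_smul x]
  rw [← hM.add_smul, hM.const_add, neg_add_cancel]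

lemma smul_smul_const_zero {X : C} (a : M.carrier (𝟙_ C)) (x : M.carrier X) :
    M.smul a (M.smul (M.const 0) x) = M.smul (M.const 0) x := by
  rw [← hM.mul_smul, hM.L_mul_comm, hM.mul_smul]
  exact M.smul_const_zero_eq _ _

instance (X : C) : Zero (M.carrier X) := ⟨M.smul (M.const 0) (Classical.arbitrary _)⟩

instance (X : C) : Add (M.carrier X) := ⟨M.add⟩

instance (X : C) : Neg (M.carrier X) := ⟨M.smul (M.const (-1))⟩

instance (X : C) : AddCommGroup (M.carrier X) where
  add_assoc := hM.add_assoc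
  zero_add x := (hM.add_comm _ _).trans (hM.add_zero x _)
  add_zero x := hM.add_zero x _
  neg_add_cancel x := (M.neg_add x).trans (M.smul_const_zero_eq _ _)
  add_comm := hM.add_comm
  nsmul := nsmulRec
  zsmul := zsmulRec

instance : Zero M.L := ⟨M.const 0⟩

instance : One M.L := ⟨M.const 1⟩

instance : Add M.L := ⟨M.add (X := 𝟙_ C)⟩

instance : Neg M.L := ⟨M.smul (X := 𝟙_ C) (M.const (-1))⟩

instance : Mul M.L := ⟨M.smul (X := 𝟙_ C)⟩

open Classical in
instance : Inv M.L := ⟨fun a => if h : ∃ b : M.L, a * b = 1 then h.choose else 0⟩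

instance : Field M.L where
  add_assoc := hM.add_assoc (X := 𝟙_ C)
  zero_add := M.L_zero_add
  add_zero := hM.L_add_zero
  neg_add_cancel a := (M.neg_add (X := 𝟙_ C) a).trans (M.const_zero_smul a)
  add_comm := hM.add_comm (X := 𝟙_ C)
  mul_assoc := hM.mul_smul (X := 𝟙_ C)
  mul_comm := hM.L_mul_comm
  one_mul := hM.one_smul (X := 𝟙_ C)
  mul_one a := (hM.L_mul_comm _ _).trans (hM.one_smul (X := 𝟙_ C) a)
  left_distrib := hM.smul_add (X := 𝟙_ C)
  right_distrib := hM.add_smul (X := 𝟙_ C)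
  zero_mul := M.const_zero_smul
  mul_zero a := (hM.L_mul_comm _ _).trans (M.const_zero_smul a)
  exists_pair_ne := ⟨0, 1, hM.L_zero_ne_one⟩
  mul_inv_cancel a ha := by
    have h : ∃ b : M.L, a * b = 1 := hM.L_inv a ha
    simp only [Inv.inv, dif_pos h]
    exact h.choose_spec
  inv_zero := dif_neg fun ⟨b, hb⟩ => hM.L_zero_ne_one ((M.const_zero_smul b).symm.trans hb)
  nsmul := nsmulRec
  zsmul := zsmulRec
  qsmul := _
  nnqsmul := _

instance (X : C) : Module M.L (M.carrier X) where
  smul := M.smul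
  one_smul := hM.one_smul
  mul_smul := hM.mul_smul
  smul_zero a := M.smul_smul_const_zero a _
  smul_add := hM.smul_add
  add_smul := hM.add_smul
  zero_smul x := M.smul_const_zero_eq x _

instance compatibleRing : FirstOrder.Ring.CompatibleRing M.L where
  toStructure := M.ringStructure
  funMap_add _ := rfl
  funMap_mul _ := rfl
  funMap_neg _ := rfl
  funMap_zero _ := rfl
  funMap_one _ := rfl

variable {M}

omit [Field K] hM in
lemma add_eq {X : C} (x y : M.carrier X) : M.add x y = x + y := rfl

variable (M) in
/-- The identity map from the sort `V_𝟙`, seen as a vector space, to the field `L`. It keeps apart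
the two algebraic structures that live on the same type. -/
def scalar : M.carrier (𝟙_ C) ≃ₗ[M.L] M.L where
  toFun a := a
  map_add' _ _ := rfl
  map_smul' _ _ := rfl
  invFun a := a
  left_inv _ := rfl
  right_inv _ := rfl

lemma smul_eq {X : C} (a : M.carrier (𝟙_ C)) (x : M.carrier X) :
    M.smul a x = M.scalar a • x := rfl

lemma const_zero : M.const 0 = 0 :=
  M.scalar.injective ((map_zero M.scalar).symm)

variable (M) in
/-- The inclusion of the constants into `L`. -/
def constHom : K →+* M.L where
  toFun := M.const
  map_one' := rfl
  map_mul' a b := (hM.const_mul a b).symm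
  map_zero' := rfl
  map_add' a b := (hM.const_add a b).symm

lemma value_zero (a : M.Assignment) (X : C) : (Term.zero X : Term C K X).value M a = 0 :=
  M.smul_const_zero_eq _ _

lemma value_lincomb (v : M.Assignment) {X : C} {n : ℕ} (a : Fin n → Term C K (𝟙_ C))
    (t : Fin n → Term C K X) :
    (Term.lincomb a t).value M v = ∑ i, M.scalar ((a i).value M v) • (t i).value M v := by
  rw [← List.sum_ofFn, Term.lincomb]
  have (l : List (Term C K X)) :
      (l.foldr Term.add (Term.zero X)).value M v = (l.map fun t => t.value M v).sum := by
    induction l with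
    | nil => exact value_zero v X
    | cons t l ih => simpa [Term.value, add_eq] using ih
  rw [this, List.map_ofFn]
  rfl

lemma value_pow (v : M.Assignment) (t : Term C K (𝟙_ C)) (n : ℕ) :
    M.scalar ((t.pow n).value M v) = M.scalar (t.value M v) ^ n := by
  induction n with
  | zero => rfl
  | succ n ih => rw [pow_succ', ← ih]; rfl

end VectorSpaces

section LinearMaps

variable {M : Struct.{v, u, r, w} C K} [hM : M.IsLinear]

variable (M) in
/-- The linear map `v_f`. -/
def linearMap {X Y : C} (f : X ⟶ Y) : M.carrier X →ₗ[M.L] M.carrier Y where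
  toFun := M.map f
  map_add' := hM.map_add f
  map_smul' := hM.map_smul f

variable (M) in
/-- The bilinear map `b_{X,Y}`. -/
def bilinearMap (X Y : C) : M.carrier X →ₗ[M.L] M.carrier Y →ₗ[M.L] M.carrier (X ⊗ Y) :=
  LinearMap.mk₂ M.L M.tensor hM.tensor_add_left hM.tensor_smul_left hM.tensor_add_right
    (fun a x y => hM.tensor_smul_right a x y)

lemma map_eq {X Y : C} (f : X ⟶ Y) (x : M.carrier X) : M.map f x = M.linearMap f x := rfl

lemma tensor_eq {X Y : C} (x : M.carrier X) (y : M.carrier Y) :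
    M.tensor x y = M.bilinearMap X Y x y := rfl

end LinearMaps

end Struct

end LinearStructure

section Axioms

open Formula Term

section Realize

variable {C : Type u} [Category.{v} C] [MonoidalCategory C] {K : Type r} [Field K]
  {M : Struct.{v, u, r, w} C K} [M.HasVectorSpaces] {v : M.Assignment}

lemma realize_basisFormula {X : C} {N n : ℕ} {t : Fin n → Term C K X} {x : Fin n → M.carrier X}
    (ht : ∀ v' : M.Assignment, (∀ Y, ∀ m < N, v' Y m = v Y m) → ∀ i, (t i).value M v' = x i) :
    (basisFormula N t).Realize M v ↔
      Submodule.span M.L (Set.range x) = ⊤ ∧ LinearIndependent M.L x := by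
  have ht₁ (y : M.carrier X) (c : Fin n → M.carrier (𝟙_ C)) (i : Fin n) :
      (t i).value M ((v.update X (N + n) y).updateBlock (𝟙_ C) N c) = x i :=
    ht _ (fun Y m hm => by simp [hm, (hm.trans_le (Nat.le_add_right N n)).ne]) i
  have ht₂ (c : Fin n → M.carrier (𝟙_ C)) (i : Fin n) :
      (t i).value M (v.updateBlock (𝟙_ C) N c) = x i :=
    ht _ (fun Y m hm => by simp [hm]) i
  rw [basisFormula, realize_and]
  refine and_congr ?_ ?_
  · simp only [Realize, realize_exBlock, M.value_lincomb, ht₁, value,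
      Struct.Assignment.updateBlock_add, Struct.Assignment.updateBlock_of_le, le_refl,
      Struct.Assignment.update_same, Submodule.eq_top_iff', Submodule.mem_span_range_iff_exists_fun]
    exact forall_congr' fun y =>
      ⟨fun ⟨c, hc⟩ => ⟨M.scalar ∘ c, hc.symm⟩, fun ⟨c, hc⟩ => ⟨M.scalar.symm ∘ c, hc.symm⟩⟩
  · simp only [realize_allBlock, Realize, M.value_lincomb, M.value_zero, ht₂, value,
      Struct.Assignment.updateBlock_add, realize_conj, List.forall_mem_ofFn_iff,
      Fintype.linearIndependent_iff]
    exact ⟨fun h g hg i => h (M.scalar.symm ∘ g) hg i, fun h c hc i => h (M.scalar ∘ c) hc i⟩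

lemma realize_dimFormula {X : C} {n : ℕ} :
    (dimFormula X n).Realize M v ↔
      Nonempty (Module.Basis (Fin n) M.L (M.carrier X)) := by
  have hbasis (x : Fin n → M.carrier X) :
      (basisFormula n fun i : Fin n => var X i).Realize M (v.updateBlock X 0 x) ↔
        Submodule.span M.L (Set.range x) = ⊤ ∧ LinearIndependent M.L x :=
    realize_basisFormula fun v' hv' i => by simp [value, hv' X i i.2]
  simp only [dimFormula, realize_exBlock, hbasis]
  exact ⟨fun ⟨_, hspan, hli⟩ => ⟨.mk hli hspan.ge⟩,
    fun ⟨b⟩ => ⟨b, b.span_eq, b.linearIndependent⟩⟩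

lemma realize_rootFormula {n : ℕ} :
    (rootFormula n).Realize M v ↔
      ∃ x : M.L, x ^ n + ∑ i : Fin n, M.scalar (v (𝟙_ C) i) * x ^ (i : ℕ) = 0 := by
  have hvar (x : M.carrier (𝟙_ C)) (i : Fin n) : v.update (𝟙_ C) n x (𝟙_ C) i = v (𝟙_ C) i :=
    v.update_of_ne _ _ x i.2.ne
  simp only [rootFormula, realize_ex, Realize, value, M.const_zero, M.add_eq]
  simp only [← M.scalar.map_eq_zero_iff, map_add, M.value_pow, M.value_lincomb, map_sum, map_smul,
    value, Struct.Assignment.update_same, hvar, smul_eq_mul]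
  exact Iff.rfl

end Realize

namespace Struct.Models

variable {k : Type*} [Field k] {C : Type u} [Category.{v} C] [Abelian C] [MonoidalCategory C]
  [SymmetricCategory C] [RigidCategory C] [Linear k C] {K : Type r} [Field K] [Algebra k K]
  {M : Struct.{v, u, r, w} C K} (hM : M.Models (theory k C K))

include hM

lemma realize_axiom {φ : Formula C K} (h : IsAxiom k C K φ) (a : M.Assignment) :
    φ.Realize M a :=
  hM φ h a

lemma hasVectorSpaces : M.HasVectorSpaces := by
  let a : M.Assignment := Classical.arbitrary _
  exact {
    add_assoc {X} x y z := by
      simpa [Realize, value] using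
        hM.realize_axiom (.add_assoc X) (((a.update X 0 x).update X 1 y).update X 2 z)
    add_comm {X} x y := by
      simpa [Realize, value] using
        hM.realize_axiom (.add_comm X) ((a.update X 0 x).update X 1 y)
    add_zero {X} x y := by
      simpa [Realize, value, zero] using
        hM.realize_axiom (.add_zero X) ((a.update X 1 x).update X 0 y)
    smul_add {X} b x y := by
      simpa [Realize, value] using
        hM.realize_axiom (.smul_add X) (((a.update X 0 x).update X 1 y).update _ 3 b)
    add_smul {X} b c x := by
      simpa [Realize, value] using
        hM.realize_axiom (.add_smul X) (((a.update X 0 x).update _ 3 b).update _ 4 c)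
    mul_smul {X} b c x := by
      simpa [Realize, value] using
        hM.realize_axiom (.mul_smul X) (((a.update X 0 x).update _ 3 b).update _ 4 c)
    one_smul {X} x := by
      simpa [Realize, value] using hM.realize_axiom (.one_smul X) (a.update X 0 x)
    L_add_zero b := by
      simpa [Realize, value] using hM.realize_axiom .L_add_zero (a.update _ 3 b)
    L_mul_comm b c := by
      simpa [Realize, value] using
        hM.realize_axiom .L_mul_comm ((a.update _ 3 b).update _ 4 c)
    L_zero_ne_one := by
      simpa [Realize, value] using hM.realize_axiom .L_zero_ne_one a
    L_inv b := by
      simpa [Realize, value] using hM.realize_axiom .L_inv (a.update _ 3 b)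
    const_add b c := by
      simpa [Realize, value] using hM.realize_axiom (.const_add b c) a
    const_mul b c := by
      simpa [Realize, value] using hM.realize_axiom (.const_mul b c) a }

lemma isLinear : M.IsLinear := by
  let a : M.Assignment := Classical.arbitrary _
  exact {
    toHasVectorSpaces := hM.hasVectorSpaces
    map_add {X Y} f x y := by
      simpa [Realize, value] using
        hM.realize_axiom (.map_add f) ((a.update X 0 x).update X 1 y)
    map_smul {X Y} f b x := by
      simpa [Realize, value] using
        hM.realize_axiom (.map_smul f) ((a.update X 0 x).update _ 3 b)
    tensor_add_left {X Y} x x' y := by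
      simpa [Realize, value] using
        hM.realize_axiom (.tensor_add_left X Y)
          (((a.update X 0 x).update X 1 x').update Y 2 y)
    tensor_add_right {X Y} x y y' := by
      simpa [Realize, value] using
        hM.realize_axiom (.tensor_add_right X Y)
          (((a.update X 0 x).update Y 1 y).update Y 2 y')
    tensor_smul_left {X Y} b x y := by
      simpa [Realize, value] using
        hM.realize_axiom (.tensor_smul_left X Y)
          (((a.update X 0 x).update Y 1 y).update _ 3 b)
    tensor_smul_right {X Y} b x y := by
      simpa [Realize, value] using
        hM.realize_axiom (.tensor_smul_right X Y)
          (((a.update X 0 x).update Y 1 y).update _ 3 b) }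

variable [M.HasVectorSpaces]

lemma isAlgClosed : IsAlgClosed M.L := by
  refine IsAlgClosed.of_exists_root _ fun p hmonic hirr => ?_
  let v : M.Assignment := (Classical.arbitrary M.Assignment).updateBlock (𝟙_ C) 0
    fun i : Fin p.natDegree => M.scalar.symm (p.coeff i)
  have hv (i : Fin p.natDegree) : M.scalar (v (𝟙_ C) i) = p.coeff i := by
    simp only [v, Struct.Assignment.updateBlock_zero_apply, LinearEquiv.apply_symm_apply]
  obtain ⟨x, hx⟩ := realize_rootFormula.mp (hM.realize_axiom (.L_root _ hirr.natDegree_pos) v)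
  refine ⟨x, ?_⟩
  rw [hmonic.as_sum, Polynomial.eval_add, Polynomial.eval_finsetSum, Finset.sum_range]
  simpa only [hv, Polynomial.eval_pow, Polynomial.eval_X, Polynomial.eval_mul,
    Polynomial.eval_C] using hx

lemma nonempty_basis {X : C} {n : ℕ} (hn : HasRank X n) :
    Nonempty (Module.Basis (Fin n) M.L (M.carrier X)) :=
  realize_dimFormula.mp (hM.realize_axiom (.dim X n hn) (Classical.arbitrary _))

end Struct.Models

end Axioms

section Translation

open FirstOrder

variable (C : Type u) [Category.{v} C] [MonoidalCategory C] (K : Type r) (d : C → ℕ)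

/-- Variables for the scalars that describe a model, together with an assignment, with respect to
bases of all sorts, where `d X` is the dimension of `V_X`: the coordinates of all variables, the
structure constants of all `v_f` and `b_{X,Y}`, the coordinates of the constants, and the basis
elements of `L` viewed as scalars. -/
inductive CoordVar : Type (max u v r)
  | var (X : C) (n : ℕ) (i : Fin (d X)) : CoordVar
  | map {X Y : C} (f : X ⟶ Y) (i : Fin (d X)) (j : Fin (d Y)) : CoordVar
  | tensor (X Y : C) (i : Fin (d X)) (j : Fin (d Y)) (l : Fin (d (X ⊗ Y))) : CoordVar
  | const (c : K) (i : Fin (d (𝟙_ C))) : CoordVar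
  | scalar (i : Fin (d (𝟙_ C))) : CoordVar

variable {C K d}

/-- The coordinates of a term, as polynomials in the scalars of `CoordVar`. -/
def Term.coord : ∀ {X : C}, Term C K X → Fin (d X) → FreeCommRing (CoordVar C K d)
  | _, .var X n => fun i => .of (.var X n i)
  | _, .const c => fun i => .of (.const c i)
  | _, .map f t => fun j => ∑ i, .of (.map f i j) * t.coord i
  | _, .add s t => fun i => s.coord i + t.coord i
  | _, .smul a t => fun i => (∑ j, .of (.scalar j) * a.coord j) * t.coord i
  | _, .tensor (X := X) (Y := Y) s t => fun l =>
      ∑ i, ∑ j, .of (.tensor X Y i j l) * (s.coord i * t.coord j)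

open Classical in
/-- Separation of the coordinates of the `n`-th variable of the sort `V_X`, which are about to be
quantified, from all other scalars. -/
def CoordVar.split (X : C) (n : ℕ) : CoordVar C K d → CoordVar C K d ⊕ Fin (d X)
  | .var Y m i => if h : Y = X ∧ m = n then .inr (i.cast (congrArg d h.1)) else .inl (.var Y m i)
  | c => .inl c

/-- The translation of a formula into the language of rings, in terms of coordinates. -/
def Formula.toRing : Formula C K → Language.ring.Formula (CoordVar C K d)
  | .falsum => ⊥
  | .equal s t => Language.BoundedFormula.iInf fun i =>
      (Ring.termOfFreeCommRing (s.coord i)).equal (Ring.termOfFreeCommRing (t.coord i))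
  | .imp φ ψ => φ.toRing.imp ψ.toRing
  | .all X n φ => Language.Formula.iAlls (Fin (d X)) (φ.toRing.relabel (CoordVar.split X n))

variable [Field K] {M : Struct.{v, u, r, w} C K} [M.IsLinear]
  (B : ∀ X : C, Module.Basis (Fin (d X)) M.L (M.carrier X))

/-- The scalars that describe the model `M` and the assignment `a` with respect to the bases
`B`. -/
def CoordVar.value (a : M.Assignment) : CoordVar C K d → M.L
  | .var X n i => (B X).repr (a X n) i
  | .map (X := X) (Y := Y) f i j => (B Y).repr (M.map f (B X i)) j
  | .tensor X Y i j l => (B (X ⊗ Y)).repr (M.tensor (B X i) (B Y j)) l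
  | .const c i => (B (𝟙_ C)).repr (M.const c) i
  | .scalar i => M.scalar (B (𝟙_ C) i)

lemma Term.lift_coord (a : M.Assignment) {X : C} (t : Term C K X) (i : Fin (d X)) :
    FreeCommRing.lift (CoordVar.value B a) (t.coord i) = (B X).repr (t.value M a) i := by
  induction t with
  | var X n => simp [coord, CoordVar.value, value]
  | const c => simp [coord, CoordVar.value, value]
  | @map X Y f t ih =>
    simp only [coord, map_sum, map_mul, FreeCommRing.lift_of, ih, CoordVar.value, value]
    conv_rhs => rw [← (B X).sum_repr (t.value M a), Struct.map_eq]
    simp only [Struct.map_eq, map_sum, _root_.map_smul, Finsupp.coe_finsetSum, Finset.sum_apply,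
      Finsupp.smul_apply, smul_eq_mul, mul_comm]
  | add s t ihs iht => simp [coord, ihs, iht, value, M.add_eq]
  | smul s t ihs iht =>
    simp only [coord, map_sum, map_mul, FreeCommRing.lift_of, ihs, iht, CoordVar.value, value,
      M.smul_eq, _root_.map_smul, Finsupp.smul_apply, smul_eq_mul]
    congr 1
    conv_rhs => rw [← (B (𝟙_ C)).sum_repr (s.value M a)]
    simp only [map_sum, _root_.map_smul, smul_eq_mul, mul_comm]
  | @tensor X Y s t ihs iht =>
    simp only [coord, map_sum, map_mul, FreeCommRing.lift_of, ihs, iht, CoordVar.value, value]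
    conv_rhs => rw [← (B X).sum_repr (s.value M a), ← (B Y).sum_repr (t.value M a), M.tensor_eq]
    simp only [map_sum, _root_.map_smul, LinearMap.sum_apply, LinearMap.smul_apply,
      Finsupp.coe_finsetSum, Finset.sum_apply, Finsupp.smul_apply, smul_eq_mul, Finset.mul_sum,
      M.tensor_eq]
    rw [Finset.sum_comm]
    exact Finset.sum_congr rfl fun i _ => Finset.sum_congr rfl fun j _ => by ring

lemma CoordVar.elim_value_comp_split (a : M.Assignment) (X : C) (n : ℕ) (x : M.carrier X) :
    Sum.elim (CoordVar.value B a) ((B X).repr x) ∘ CoordVar.split X n =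
      CoordVar.value B (a.update X n x) := by
  funext c
  cases c with
  | var Y m i =>
    by_cases h : Y = X ∧ m = n
    · obtain ⟨rfl, rfl⟩ := h
      simp [split, value]
    · have ha : a.update X n x Y m = a Y m := by
        rcases not_and_or.mp h with hY | hm
        · exact a.update_of_ne_sort _ _ _ hY
        · exact a.update_of_ne _ _ _ hm
      simp [split, value, h, ha]
  | _ => rfl

lemma Formula.realize_toRing (φ : Formula C K) (a : M.Assignment) :
    (φ.toRing (d := d)).Realize (CoordVar.value B a) ↔ φ.Realize M a := by
  induction φ generalizing a with
  | falsum => exact Iff.rfl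
  | @equal X s t =>
    simp only [toRing, Language.Formula.Realize, Language.BoundedFormula.realize_iInf]
    simp only [← Language.Formula.Realize.eq_1, Language.Formula.realize_equal,
      Ring.realize_termOfFreeCommRing, Term.lift_coord, Realize]
    rw [← (B X).repr.injective.eq_iff, DFunLike.ext_iff]
  | imp φ ψ h₁ h₂ =>
    simp only [toRing, Realize, ← h₁, ← h₂]
    exact Language.BoundedFormula.realize_imp
  | all X n φ ih =>
    simp only [toRing, Realize, Language.Formula.realize_iAlls, Language.Formula.realize_relabel]
    rw [← (B X).equivFun.toEquiv.forall_congr_right]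
    refine forall_congr' fun x => ?_
    rw [← ih, ← CoordVar.elim_value_comp_split]
    rfl

open Classical in
/-- Substitution of the values of the first `n` variables of the sort `L` for their coordinates:
the coordinates of `y : L` are `y` times those of the constant `1`. -/
def CoordVar.substL (n : ℕ) : CoordVar C K d → Language.ring.Term (CoordVar C K d ⊕ Fin n)
  | .var X m i =>
      if h : X = 𝟙_ C ∧ m < n then
        .var (.inr ⟨m, h.2⟩) * .var (.inl (.const 1 (i.cast (congrArg d h.1))))
      else .var (.inl (.var X m i))
  | c => .var (.inl c)

lemma CoordVar.realize_substL (a : M.Assignment) {n : ℕ} (y : Fin n → M.L) (c : CoordVar C K d) :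
    (c.substL n).realize (Sum.elim (CoordVar.value B a) y) = c.value B (a.setL y) := by
  rw [a.setL_eq_updateBlock]
  cases c with
  | var X m i =>
    by_cases h : X = 𝟙_ C ∧ m < n
    · obtain ⟨rfl, hm⟩ := h
      have hy : a.updateBlock (𝟙_ C) 0 (n := n) y (𝟙_ C) m =
          y ⟨m, hm⟩ • (M.const 1 : M.carrier (𝟙_ C)) :=
        (a.updateBlock_zero_apply (𝟙_ C) (n := n) y ⟨m, hm⟩).trans
          (mul_one (M := M.L) (y ⟨m, hm⟩)).symm
      simp [substL, value, hm, hy]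
    · have ha : a.updateBlock (𝟙_ C) 0 (n := n) y X m = a X m := by
        rcases not_and_or.mp h with hX | hm
        · exact a.updateBlock_of_ne_sort _ _ _ hX
        · exact a.updateBlock_of_le _ _ _ (by omega)
      simp [substL, value, h, ha]
  | _ => rfl

lemma exists_ringFormula (d : C → ℕ) (φ : Formula C K) (n : ℕ) :
    ∃ (m : ℕ) (ι : Fin m → CoordVar C K d) (ψ : Language.ring.Formula (Fin m ⊕ Fin n)),
      ∀ (M : Struct.{v, u, r, w} C K) [M.IsLinear]
        (B : ∀ X : C, Module.Basis (Fin (d X)) M.L (M.carrier X)) (a : M.Assignment)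
        (y : Fin n → M.L), φ.Realize M (a.setL y) ↔
          ψ.Realize (Sum.elim (CoordVar.value B a ∘ ι) y) := by
  obtain ⟨m, ι, ψ, h⟩ := ACFDefinable.exists_restrict_realize.{w}
    (φ.toRing.subst (CoordVar.substL (C := C) (K := K) (d := d) n))
  refine ⟨m, ι, ψ, fun M _ B a y => ?_⟩
  rw [← φ.realize_toRing B, ← h]
  refine Iff.trans ?_ Language.BoundedFormula.realize_subst.symm
  simp only [CoordVar.realize_substL]
  rfl

open Classical in
lemma CoordVar.value_merge (P : Set (C × ℕ)) (a b : M.Assignment) :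
    CoordVar.value B (a.merge P b) =
      {c : CoordVar C K d | ∀ X n i, c = .var X n i → (X, n) ∈ P}.piecewise
        (CoordVar.value B a) (CoordVar.value B b) := by
  funext c
  cases c with
  | var X n i => by_cases h : (X, n) ∈ P <;> simp [Set.piecewise, value, Struct.Assignment.merge, h]
  | _ => simp [Set.piecewise, value]

lemma not_realize_merge_iff_lt [IsAlgClosed M.L]
    (B : ∀ X : C, Module.Basis (Fin (d X)) M.L (M.carrier X)) (φ : Formula C K) (P : Set (C × ℕ))
    (a b : ℕ → M.Assignment) :
    ¬ ∀ i j : ℕ, φ.Realize M (Struct.Assignment.merge P (a i) (b j)) ↔ i < j := by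
  classical
  simp only [← φ.realize_toRing B, CoordVar.value_merge]
  exact (ACFDefinable.finitelyDetermined_realize φ.toRing).not_piecewise_mem_iff_lt _ _ _

end Translation

section Theory

variable {k : Type*} [Field k] {C : Type u} [Category.{v} C] [Abelian C] [MonoidalCategory C]
  [SymmetricCategory C] [RigidCategory C] [Linear k C]

theorem stable_theory (hrank : ∀ X : C, ∃ n : ℕ, HasRank X n)
    (K : Type r) [Field K] [Algebra k K] : Stable.{v, u, r, w} (theory k C K) := by
  intro M hM φ P a b
  choose d hd using hrank
  have := hM.isLinear
  have := hM.isAlgClosed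
  exact not_realize_merge_iff_lt (fun X => (hM.nonempty_basis (hd X)).some) φ P a b

theorem stablyEmbedded_theory (hrank : ∀ X : C, ∃ n : ℕ, HasRank X n)
    (K : Type r) [Field K] [Algebra k K] : StablyEmbedded.{v, u, r, w} (theory k C K) := by
  intro φ n
  choose d hd using hrank
  obtain ⟨m, ι, ψ, h⟩ := exists_ringFormula.{v, u, r, w} d φ n
  refine ⟨m, ψ, fun M hM a => ?_⟩
  have := hM.isLinear
  exact ⟨_, h M (fun X => (hM.nonempty_basis (hd X)).some) a⟩

end Theory

open FirstOrder Formula Term Struct.Assignment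

section InducedStructure

variable {C : Type u} [Category.{v} C] [MonoidalCategory C] {K : Type r}
  {M : Struct.{v, u, r, w} C K} {m n : ℕ}

lemma Struct.Assignment.setL_apply (a : M.Assignment) (x : Fin m → M.L) (i : Fin m) :
    a.setL x (𝟙_ C) i = x i := by
  simp only [setL, Function.update_self]
  exact dif_pos i.2

lemma Struct.Assignment.updateBlock_setL (a : M.Assignment) {N : ℕ} (h : m ≤ N)
    (x : Fin m → M.L) (y : Fin n → M.carrier (𝟙_ C)) :
    (a.setL x).updateBlock (𝟙_ C) N y = (a.updateBlock (𝟙_ C) N y).setL x := by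
  ext X l
  by_cases hX : X = 𝟙_ C
  · subst hX
    by_cases hl : l < m
    · rw [updateBlock_of_lt _ _ _ _ (by omega)]
      exact (setL_apply a x ⟨l, hl⟩).trans (setL_apply _ x ⟨l, hl⟩).symm
    · simp only [setL, updateBlock, Function.update_self]
      simp [Function.extend, hl]
  · simp [setL, updateBlock, hX]

namespace Struct.DefinableL

lemma empty : M.DefinableL (∅ : Set (Fin n → M.L)) :=
  ⟨falsum, fun _ _ => Iff.rfl⟩

lemma himp {S T : Set (Fin n → M.L)} (hS : M.DefinableL S) (hT : M.DefinableL T) :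
    M.DefinableL (S ⇨ T) := by
  obtain ⟨φ, hφ⟩ := hS
  obtain ⟨ψ, hψ⟩ := hT
  exact ⟨imp φ ψ, fun a y => by simp [Formula.Realize, ← hφ, ← hψ]⟩

lemma forall_snoc {S : Set (Fin (n + 1) → M.L)} (hS : M.DefinableL S) :
    M.DefinableL {x : Fin n → M.L | ∀ c : M.L, (Fin.snoc x c : Fin (n + 1) → M.L) ∈ S} := by
  obtain ⟨φ, hφ⟩ := hS
  refine ⟨all (𝟙_ C) n φ, fun a x => forall_congr' fun c => ?_⟩
  have hupdate := a.update_updateBlock (𝟙_ C) 0 (n := n) x c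
  rw [zero_add] at hupdate
  rw [hφ a, setL_eq_updateBlock, setL_eq_updateBlock, hupdate]
  rfl

lemma setOf_value_eq {f g : (Fin n → M.L) → M.L} (s t : Term C K (𝟙_ C))
    (hs : ∀ (a : M.Assignment) x, s.value M (a.setL x) = f x)
    (ht : ∀ (a : M.Assignment) x, t.value M (a.setL x) = g x) : M.DefinableL {x | f x = g x} :=
  ⟨equal s t, fun a x => by simp only [Formula.Realize, hs, ht]; rfl⟩

lemma preimage_value {S : Set (Fin n → M.L)} (hS : M.DefinableL S)
    {f : Fin n → (Fin m → M.L) → M.carrier (𝟙_ C)} (t : Fin n → Term C K (𝟙_ C))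
    (ht : ∀ i (a : M.Assignment) x, (t i).value M (a.setL x) = f i x) :
    M.DefinableL {x | (fun i => f i x) ∈ S} := by
  obtain ⟨φ, hφ⟩ := hS
  let N := max m n
  let graph : Formula C K := conj (List.ofFn fun i => equal (var (𝟙_ C) (N + i)) (t i))
  let copy : Formula C K :=
    conj (List.ofFn fun i : Fin n => equal (var (𝟙_ C) i) (var (𝟙_ C) (N + i)))
  have hgraph (a : M.Assignment) (x : Fin m → M.L) (y : Fin n → M.carrier (𝟙_ C)) :
      graph.Realize M ((a.setL x).updateBlock (𝟙_ C) N y) ↔ y = fun i => f i x := by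
    have hvalue (i) : (t i).value M ((a.setL x).updateBlock (𝟙_ C) N y) = f i x := by
      rw [updateBlock_setL a (le_max_left m n), ht]
    simp only [graph, realize_conj, List.forall_mem_ofFn_iff, Formula.Realize, hvalue, value,
      updateBlock_add, funext_iff]
  have hcopy (a : M.Assignment) (y z : Fin n → M.carrier (𝟙_ C)) :
      copy.Realize M ((a.updateBlock (𝟙_ C) N y).updateBlock (𝟙_ C) 0 z) ↔ z = y := by
    simp only [copy, realize_conj, List.forall_mem_ofFn_iff, Formula.Realize, value, N,
      updateBlock_zero_apply, funext_iff]
    refine forall_congr' fun i => ?_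
    rw [updateBlock_of_le _ _ _ _ (by omega), updateBlock_add]
  refine ⟨allBlock (𝟙_ C) N n (imp graph (allBlock (𝟙_ C) 0 n (imp copy φ))), fun a x => ?_⟩
  simp only [realize_allBlock, Formula.Realize, hgraph, hcopy, forall_eq]
  exact (hφ _ _).trans (iff_of_eq (congrArg _ (setL_eq_updateBlock _ _)))

end Struct.DefinableL

variable (M) in
/-- The relation symbols for the subsets of the powers of `L` that are definable in `M` without
parameters. -/
def inducedRelations : Language where
  Functions _ := Empty
  Relations n := {S : Set (Fin n → M.L) // M.DefinableL S}

instance : (inducedRelations M).Structure M.L where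
  funMap f := nomatch f
  RelMap S x := x ∈ S.1

variable (M) in
/-- The language of the structure that `M` induces on `L`: that of rings, together with relation
symbols for the sets that are definable without parameters. -/
abbrev inducedLanguage : Language := Language.ring.sum (inducedRelations M)

variable [Field K]

lemma exists_value_setL_eq_realize (t : (inducedLanguage M).Term (Fin n)) :
    ∃ s : Term C K (𝟙_ C), ∀ (a : M.Assignment) (x : Fin n → M.L),
      s.value M (a.setL x) = t.realize x := by
  induction t with
  | var i => exact ⟨var (𝟙_ C) i, fun a x => a.setL_apply x i⟩
  | func f ts ih =>
    choose s hs using ih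
    rcases f with f | f
    · cases f with
      | add => exact ⟨.add (s 0) (s 1), fun a x => congrArg₂ M.add (hs 0 a x) (hs 1 a x)⟩
      | mul => exact ⟨.smul (s 0) (s 1), fun a x => congrArg₂ M.smul (hs 0 a x) (hs 1 a x)⟩
      | neg =>
        exact ⟨.smul (.const (-1)) (s 0), fun a x => congrArg (M.smul (M.const (-1))) (hs 0 a x)⟩
      | zero => exact ⟨.const 0, fun a x => rfl⟩
      | one => exact ⟨.const 1, fun a x => rfl⟩
    · exact f.elim

lemma definableL_boundedFormula_realize (φ : (inducedLanguage M).BoundedFormula (Fin m) n) :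
    M.DefinableL {x : Fin (m + n) → M.L | φ.Realize (x ∘ Fin.castAdd n) (x ∘ Fin.natAdd m)} := by
  have hterm {n : ℕ} (t : (inducedLanguage M).Term (Fin m ⊕ Fin n)) :
      ∃ s : Term C K (𝟙_ C), ∀ (a : M.Assignment) (x : Fin (m + n) → M.L), s.value M (a.setL x) =
        t.realize (Sum.elim (x ∘ Fin.castAdd n) (x ∘ Fin.natAdd m)) := by
    obtain ⟨s, hs⟩ := exists_value_setL_eq_realize (t.relabel finSumFinEquiv)
    refine ⟨s, fun a x => (hs a x).trans ?_⟩
    rw [Language.Term.realize_relabel]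
    congr 1
    ext (i | i) <;> simp
  induction φ with
  | falsum => exact .empty
  | equal t₁ t₂ =>
    obtain ⟨s₁, hs₁⟩ := hterm t₁
    obtain ⟨s₂, hs₂⟩ := hterm t₂
    exact .setOf_value_eq s₁ s₂ hs₁ hs₂
  | rel R ts =>
    rcases R with R | R
    · exact R.elim
    · choose s hs using fun i => hterm (ts i)
      exact R.2.preimage_value s hs
  | imp φ ψ hφ hψ => exact hφ.himp hψ
  | @all n φ hφ =>
    refine Eq.mp (congrArg _ (Set.ext fun x => forall_congr' fun c => ?_)) hφ.forall_snoc
    exact iff_of_eq (congrArg₂ φ.Realize (Fin.snoc_comp_castAdd x c) (Fin.snoc_comp_natAdd x c))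

lemma definable_inducedLanguage_iff {S : Set (Fin n → M.L)} :
    (∅ : Set M.L).Definable (inducedLanguage M) S ↔ M.DefinableL S := by
  rw [Set.empty_definable_iff]
  refine ⟨?_, fun hS => ?_⟩
  · rintro ⟨φ, rfl⟩
    refine Eq.mp (congrArg _ (Set.ext fun x => ?_)) (definableL_boundedFormula_realize φ)
    exact iff_of_eq (congrArg (Language.BoundedFormula.Realize φ x) (Subsingleton.elim _ _))
  · refine ⟨Language.Relations.formula (Sum.inr ⟨S, hS⟩ : (inducedLanguage M).Relations n)
      fun i => Language.Term.var i, Set.ext fun x => ?_⟩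
    exact Iff.rfl

lemma const_mem_definableElements (c : K) :
    M.const c ∈ ACFDefinable.definableElements (inducedLanguage M) M.L :=
  definable_inducedLanguage_iff.mpr <|
    .setOf_value_eq (var (𝟙_ C) 0) (.const c) (fun a x => a.setL_apply x 0) fun _ _ => rfl

end InducedStructure

section PureField

variable {k : Type*} [Field k] {C : Type u} [Category.{v} C] [Abelian C] [MonoidalCategory C]
  [SymmetricCategory C] [RigidCategory C] [Linear k C] {K : Type r} [Field K] [Algebra k K]
  {M : Struct.{v, u, r, w} C K}

lemma Struct.Models.model_ACF [CharZero k] (hM : M.Models (theory k C K)) :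
    (Language.Theory.ACF 0).Model M.L := by
  have := hM.hasVectorSpaces
  have := hM.isAlgClosed
  have := charZero_of_injective_ringHom (M.constHom.comp (algebraMap k K)).injective
  exact inferInstanceAs ((Language.Theory.ACF 0).Model M.L)

lemma Struct.DefinableL.finitelyDetermined (hrank : ∀ X : C, ∃ n : ℕ, HasRank X n)
    (hM : M.Models (theory k C K)) [M.HasVectorSpaces] {n : ℕ} {S : Set (Fin n → M.L)}
    (hS : M.DefinableL S) : ACFDefinable.FinitelyDetermined S := by
  have := hM.isAlgClosed
  obtain ⟨φ, hφ⟩ := hS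
  obtain ⟨m, ψ, h⟩ := stablyEmbedded_theory.{v, u, r, w} (k := k) hrank K φ n
  let a : M.Assignment := fun X _ => (0 : M.carrier X)
  obtain ⟨w, hw⟩ := h M hM a
  convert (ACFDefinable.finitelyDetermined_realize ψ).preimage_sumElim w using 1
  exact Set.ext fun y => (hφ a y).trans (hw y)

theorem Struct.Models.isPureACF [CharZero k] (hrank : ∀ X : C, ∃ n : ℕ, HasRank X n)
    (hM : M.Models (theory k C K)) : M.IsPureACF := by
  have := hM.hasVectorSpaces
  refine ⟨hM.model_ACF, ACFDefinable.definableElements (inducedLanguage M) M.L,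
    const_mem_definableElements, fun n S => definable_inducedLanguage_iff.symm.trans ?_⟩
  exact ACFDefinable.definable_empty_iff_of_finitelyDetermined Language.LHom.sumInl fun hS =>
    (definable_inducedLanguage_iff.mp hS).finitelyDetermined hrank hM

end PureField

end TensorTheory

end

theorem mainTheorem8_general {k : Type*} [Field k] [CharZero k]
    {C : Type u} [Category.{v} C] [Abelian C] [MonoidalCategory C] [SymmetricCategory C]
    [RigidCategory C] [Linear k C]
    (hrank : ∀ X : C, ∃ n : ℕ, TensorTheory.HasRank X n)
    (K : Type r) [Field K] [Algebra k K] :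
    TensorTheory.Stable.{v, u, r, w} (TensorTheory.theory k C K) ∧
    TensorTheory.StablyEmbedded.{v, u, r, w} (TensorTheory.theory k C K) ∧
    ∀ M : TensorTheory.Struct.{v, u, r, w} C K, M.Models (TensorTheory.theory k C K) →
      M.IsPureACF :=
  ⟨TensorTheory.stable_theory hrank K, TensorTheory.stablyEmbedded_theory hrank K,
    fun _ hM => hM.isPureACF hrank⟩

theorem mainTheorem8 {k : Type*} [Field k] [CharZero k]
    {C : Type u} [Category.{v} C] [Abelian C] [MonoidalCategory C] [SymmetricCategory C]
    [RigidCategory C] [MonoidalPreadditive C] [Linear k C] [MonoidalLinear k C]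
    (hEnd : Function.Bijective fun a : k => a • 𝟙 (𝟙_ C))
    (hrank : ∀ X : C, ∃ n : ℕ, TensorTheory.HasRank X n)
    (K : Type r) [Field K] [Algebra k K] :
    TensorTheory.Stable.{v, u, r, w} (TensorTheory.theory k C K) ∧
    TensorTheory.StablyEmbedded.{v, u, r, w} (TensorTheory.theory k C K) ∧
    ∀ M : TensorTheory.Struct.{v, u, r, w} C K, M.Models (TensorTheory.theory k C K) →
      M.IsPureACF := by
  exact mainTheorem8_general hrank K
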